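/- Let $n\ge 3$ and let $B_n$ be the braid group on $n$ strands with Artin generators $\sigma_1,\dots,\sigma_{n-1}$. Let $\prec$ denote Dehornoy's left-invariant ordering of $B_n$: $\alpha\prec\beta$ if and only if, for some $i$, the braid $\alpha^{-1}\beta$ is represented by a braid word that contains $\sigma_i$ but contains neither $\sigma_i^{-1}$ nor any $\sigma_j^{\pm1}$ with $j<i$. Let $\Delta=(\sigma_1\cdots\sigma_{n-1})(\sigma_1\cdots\sigma_{n-2})\cdots(\sigma_1\sigma_2)(\sigma_1)$. The Dehornoy floor $[\beta]_D$ is the integer $k$ with $\Delta^{2k}\preceq\beta\prec\Delta^{2k+2}$, and the fractional Dehn twist coefficient of $\beta$ is $BT(\beta)=\lim_{k\to\infty}[\beta^k]_D/k$. Let $\beta\in B_n$ be a product of $m\ge 0$ syllables $$\beta=(w_1\sigma_{i_1}w_1^{-1})^{\epsilon_1}(w_2\sigma_{i_2}w_2^{-1})^{\epsilon_2}\cdots(w_m\sigma_{i_m}w_m^{-1})^{\epsilon_m},\qquad w_j\in B_n,\ 1\le i_j\le n-1,\ \epsilon_j\in\{1,-1\},$$ and let $p_+$ and $p_-$ be the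 numbers of indices $j$ with $\epsilon_j=1$ and $\epsilon_j=-1$, respectively. Then the floors $[\beta^k]_D$ and the limit $BT(\beta)$ exist, and $$\min\{-p_-+1,\,0\}\ \le\ BT(\beta)\ \le\ \max\{p_+-1,\,0\}.$$ In particular, this holds whenever $\beta$ admits no destabilization (that is, $\beta$ is not conjugate to $w\sigma_{n-1}^{\pm1}$ with $w\in\langle\sigma_1,\dots,\sigma_{n-2}\rangle$) and $\chi_4(\hat\beta)=n-m$, where $\chi_4(\hat\beta)$ is the maximal Euler characteristic of an oriented surface smoothly embedded in the 4-ball and bounded by the closure $\hat\beta$. -/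

import Mathlib

open Filter Topology

/-- The relators of Artin's presentation of the braid group on `n` strands. The letter
`i : Fin (n - 1)` stands for the Artin generator usually written `σ_{i+1}`. -/
def braidRels (n : ℕ) : Set (FreeGroup (Fin (n - 1))) :=
  {r | ∃ i j : Fin (n - 1), (i : ℕ) + 2 ≤ (j : ℕ) ∧
      r = (FreeGroup.of i * FreeGroup.of j) * (FreeGroup.of j * FreeGroup.of i)⁻¹} ∪
  {r | ∃ i j : Fin (n - 1), (i : ℕ) + 1 = (j : ℕ) ∧
      r = (FreeGroup.of i * FreeGroup.of j * FreeGroup.of i) *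
        (FreeGroup.of j * FreeGroup.of i * FreeGroup.of j)⁻¹}

/-- Artin's braid group on `n` strands. -/
abbrev BraidGroup (n : ℕ) : Type := PresentedGroup (braidRels n)

namespace BraidGroup

variable {n : ℕ}

/-- The Artin generators. -/
def gen (i : Fin (n - 1)) : BraidGroup n := PresentedGroup.of i

/-- The braid represented by a braid word; the letter `(i, true)` stands for the generator `gen i`
and `(i, false)` for its inverse. -/
def ofWord (L : List (Fin (n - 1) × Bool)) : BraidGroup n :=
  (L.map fun x => if x.2 then gen x.1 else (gen x.1)⁻¹).prod

/-- A braid word is `σ_i`-positive if it contains the generator `σ_i`, but neither `σ_i⁻¹` nor any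
letter `σ_j` or `σ_j⁻¹` with `j < i`. -/
def IsSigmaPositiveWord (i : Fin (n - 1)) (L : List (Fin (n - 1) × Bool)) : Prop :=
  (i, true) ∈ L ∧ (i, false) ∉ L ∧ ∀ x ∈ L, i ≤ x.1

/-- `β ≻ 1` in Dehornoy's ordering: `β` is represented by a `σ_i`-positive word for some `i`. -/
def DehornoyPos (β : BraidGroup n) : Prop :=
  ∃ (i : Fin (n - 1)) (L : List (Fin (n - 1) × Bool)), IsSigmaPositiveWord i L ∧ ofWord L = β

/-- The (left-invariant) strict Dehornoy ordering: `α ≺ β` iff `α⁻¹ β ≻ 1`. -/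
def DehornoyLT (α β : BraidGroup n) : Prop := DehornoyPos (α⁻¹ * β)

/-- The non-strict Dehornoy ordering. -/
def DehornoyLE (α β : BraidGroup n) : Prop := α = β ∨ DehornoyLT α β

/-- Garside's fundamental braid
`Δ = (σ_1 σ_2 ⋯ σ_{n-1}) (σ_1 σ_2 ⋯ σ_{n-2}) ⋯ (σ_1 σ_2) (σ_1)`. -/
def garside (n : ℕ) : BraidGroup n :=
  ((List.finRange (n - 1)).reverse.map fun k =>
    (((List.finRange (n - 1)).filter fun i => i ≤ k).map gen).prod).prod

/-- `k` is the Dehornoy floor of `β`: `Δ^{2k} ≼ β ≺ Δ^{2k+2}`. -/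
def IsDehornoyFloor (β : BraidGroup n) (k : ℤ) : Prop :=
  DehornoyLE (garside n ^ (2 * k)) β ∧ DehornoyLT β (garside n ^ (2 * k + 2))

/-- The Dehornoy floor of `β`, as the largest integer `k` with `Δ^{2k} ≼ β`. -/
noncomputable def dehornoyFloor (β : BraidGroup n) : ℤ :=
  sSup {k : ℤ | DehornoyLE (garside n ^ (2 * k)) β}

/-- The fractional Dehn twist coefficient of a braid: the limit of `[β^k]_D / k` as `k → ∞`, where
`[·]_D` is the Dehornoy floor. -/
noncomputable def fdtc (β : BraidGroup n) : ℝ :=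
  limUnder atTop fun k : ℕ => (dehornoyFloor (β ^ k) : ℝ) / (k : ℝ)

end BraidGroup

/-! ### An order on the free group which is invariant under the Hurwitz action -/

/-! Generators are numbered σ_0, σ_1, …, as in the code. The braid group acts on the free group on
x_0, x_1, … by σ_i : x_i ↦ x_i x_{i+1} x_i⁻¹, x_{i+1} ↦ x_i. Nontrivial reduced words carry a planar
linear order `FreeLT` which this action preserves, and σ_i moves no word up (`hurwitz_le`). The
braids that move no element up form a conjugation-invariant monoid `descending`, hence a
bi-invariant relation `DescLE`, written ≤ here. Every nontrivial descending braid is positive for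
Dehornoy's order, so ≤ implies ≼. Moreover 1 ≤ wσ_iw⁻¹ ≤ Δ²: the second inequality holds because Δ²
is a central positive word beginning with σ_0 and all generators are conjugate.

Let β have p ≥ 1 positive syllables. Replacing negative syllables by 1 and all positive ones but one
by Δ² gives β ≤ Δ^{2(p-1)} c with c a conjugate of a generator, so β^k ≤ Δ^{2(p-1)k} c^k by
bi-invariance and centrality. Now c^k = g σ_1^k g⁻¹, where g and g⁻¹ lie below fixed powers of Δ²,
and σ_1^k ≺ Δ² for every k: Δ² is σ_0-positive and stays so after multiplication by powers of σ_1.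
This is where n ≥ 3 enters. Hence [β^k]_D ≤ (p-1)k + const. The lower bound is the same statement
for β⁻¹, and the limit exists because floors are superadditive.

All this needs Dehornoy's order to be a linear order. A σ_i-positive braid moves x_i strictly down
(`SigmaPos.act_lt`), so it is not trivial. Conversely, suppose β(x_0) ≠ x_0 starts with x_0. Then β
is σ_0-positive (`sigmaPos_of_startsZero`): the identity ∏ β(x_t) = ∏ x_t forces a way of shortening
β(x_0) by splitting a σ_0-positive factor off β (`exists_reduction`). If β(x_0) does not start with
x_0, then β⁻¹ is of the first kind. If β fixes x_0, it is a product of the remaining generators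
(`mem_tailSubgroup_of_act_zero`), and induction on n applies. Faithfulness of the action and
centrality of Δ² follow. -/

namespace HurwitzOrder

open FreeGroup

/-- The position of a letter in the planar order `x₀ < x₀⁻¹ < x₁ < x₁⁻¹ < ⋯`; the position `0` is
reserved for the base point. -/
def code (p : ℕ × Bool) : ℕ := 2 * p.1 + if p.2 then 1 else 2

/-- The position of the inverse of a letter. -/
def codeInv (p : ℕ × Bool) : ℕ := 2 * p.1 + if p.2 then 2 else 1

/-- The cyclic order of positions. -/
def Cyc (s p q : ℕ) : Prop := (s < p ∧ p < q) ∨ (p < q ∧ q < s) ∨ (q < s ∧ s < p)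

/-- The position of the first letter of a word. -/
def headCode : List (ℕ × Bool) → ℕ
  | [] => 0
  | p :: _ => code p

/-- `w` is a reduced word which does not start with the letter at position `s`. -/
def RedFrom : ℕ → List (ℕ × Bool) → Prop
  | _, [] => True
  | s, p :: w => code p ≠ s ∧ RedFrom (codeInv p) w

/-- The planar order of words, seen from the position `s`. -/
def WordLT : ℕ → List (ℕ × Bool) → List (ℕ × Bool) → Prop
  | _, [], [] => False
  | s, [], q :: _ => Cyc s 0 (code q)
  | s, p :: _, [] => Cyc s (code p) 0
  | s, p :: w, q :: w' => (p = q ∧ WordLT (codeInv p) w w') ∨ Cyc s (code p) (code q)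

theorem code_pos (p : ℕ × Bool) : 0 < code p := by
  unfold code; split_ifs <;> omega

theorem codeInv_pos (p : ℕ × Bool) : 0 < codeInv p := by
  unfold codeInv; split_ifs <;> omega

theorem code_injective : Function.Injective code := by
  rintro ⟨i, a⟩ ⟨j, b⟩ h
  cases a <;> cases b <;> simp [code] at h ⊢ <;> omega

theorem wordLT_of_headCode {s : ℕ} {w w' : List (ℕ × Bool)}
    (h : Cyc s (headCode w) (headCode w')) : WordLT s w w' := by
  cases w <;> cases w' <;> simp_all [WordLT, headCode, Cyc]

theorem wordLT_cons {s : ℕ} {p : ℕ × Bool} {w w' : List (ℕ × Bool)}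
    (h : WordLT (codeInv p) w w') : WordLT s (p :: w) (p :: w') := Or.inl ⟨rfl, h⟩

theorem wordLT_trans : ∀ {s : ℕ} {w₁ w₂ w₃ : List (ℕ × Bool)},
    WordLT s w₁ w₂ → WordLT s w₂ w₃ → WordLT s w₁ w₃
  | s, [], [], _, h, _ => h.elim
  | s, _ :: _, [], [], _, h => h.elim
  | s, [], _ :: _, [], h, h' => by simp only [WordLT, Cyc] at *; omega
  | s, [], q :: _, r :: _, h, h' => by
    simp only [WordLT] at *
    rcases h' with ⟨rfl, -⟩ | h'
    · exact h
    · simp only [Cyc] at *; omega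
  | s, p :: _, [], r :: _, h, h' => by
    simp only [WordLT] at *
    right; simp only [Cyc] at *; omega
  | s, p :: _, q :: _, [], h, h' => by
    simp only [WordLT] at *
    rcases h with ⟨rfl, -⟩ | h
    · exact h'
    · simp only [Cyc] at *; omega
  | s, p :: _, q :: _, r :: _, h, h' => by
    simp only [WordLT] at *
    rcases h with ⟨rfl, h⟩ | h
    · rcases h' with ⟨rfl, h'⟩ | h'
      · exact Or.inl ⟨rfl, wordLT_trans h h'⟩
      · exact Or.inr h'
    · rcases h' with ⟨rfl, h'⟩ | h'
      · exact Or.inr h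
      · right; simp only [Cyc] at *; omega

theorem wordLT_irrefl : ∀ {s : ℕ} {w : List (ℕ × Bool)}, ¬ WordLT s w w
  | _, [] => id
  | s, p :: w => by
    rintro (⟨-, h⟩ | h)
    · exact wordLT_irrefl h
    · simp only [Cyc] at h; omega

/-- Removing `s` from the cyclic order of positions leaves a linear order, in which the end of a
word sits at position 0. At the root `s = 0`, so the empty word is comparable with nothing and has
to be excluded there; deeper in the tree `s` is the position of a letter and never 0. -/
theorem wordLT_trichotomy : ∀ {s : ℕ} {w w' : List (ℕ × Bool)}, RedFrom s w → RedFrom s w' →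
    (w = [] → s ≠ 0) → (w' = [] → s ≠ 0) → WordLT s w w' ∨ w = w' ∨ WordLT s w' w
  | _, [], [], _, _, _, _ => Or.inr (Or.inl rfl)
  | s, [], q :: _, _, h', hs, _ => by
    have := code_pos q
    have := hs rfl
    have := h'.1
    simp only [WordLT, Cyc, reduceCtorEq, false_or]; omega
  | s, p :: _, [], h, _, _, hs => by
    have := code_pos p
    have := hs rfl
    have := h.1
    simp only [WordLT, Cyc, reduceCtorEq, false_or]; omega
  | s, p :: w, q :: w', h, h', _, _ => by
    by_cases hpq : p = q
    · subst hpq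
      have hp := codeInv_pos p
      rcases wordLT_trichotomy h.2 h'.2 (fun _ => hp.ne') (fun _ => hp.ne') with h | h | h
      · exact Or.inl (wordLT_cons h)
      · exact Or.inr (Or.inl (by rw [h]))
      · exact Or.inr (Or.inr (wordLT_cons h))
    · have h1 := h.1
      have h2 := h'.1
      have h3 : code p ≠ code q := fun e => hpq (code_injective e)
      have : Cyc s (code p) (code q) ∨ Cyc s (code q) (code p) := by
        simp only [Cyc]; omega
      rcases this with h | h
      · exact Or.inl (Or.inr h)
      · exact Or.inr (Or.inr (Or.inr h))

/-! #### The action of a generator on reduced words -/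

/-- A transducer which computes the reduced word of the image of a reduced word under the
automorphism `x i ↦ x i * x (i + 1) * (x i)⁻¹`, `x (i + 1) ↦ x i`. In the state `true` the result is
multiplied by `(x i)⁻¹` from the left. -/
def transduce (i : ℕ) : Bool → List (ℕ × Bool) → List (ℕ × Bool)
  | st, [] => if st then [(i, false)] else []
  | st, (j, e) :: w =>
    if j = i then (if st then [] else [(i, true)]) ++ (i + 1, e) :: transduce i true w
    else if j = i + 1 then
      if e then (if st then [] else [(i, true)]) ++ transduce i false w
      else (if st then [(i, false)] else []) ++ transduce i true w
    else (if st then [(i, false)] else []) ++ (j, e) :: transduce i false w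

/-- The positions outside the letters `x i`, `x (i + 1)` and their inverses. -/
def Outer (i s : ℕ) : Prop := s < 2 * i + 1 ∨ 2 * i + 4 < s

/-- The states `st` of the transducer which can occur after reading the letter inverse to `s` and
writing the letter inverse to `s'`. -/
def Compat (i s : ℕ) (st : Bool) (s' : ℕ) : Prop :=
  (st = false ∧ ((s = s' ∧ Outer i s) ∨
    (s = 2 * i + 4 ∧ (s' = 2 * i + 2 ∨ s' = 2 * i + 3 ∨ s' = 2 * i + 4)))) ∨
  (st = true ∧ ((s = 2 * i + 2 ∧ s' = 2 * i + 4) ∨ (s = 2 * i + 1 ∧ s' = 2 * i + 3) ∨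
    (s = 2 * i + 3 ∧ (s' = 2 * i + 1 ∨ Outer i s'))))

/-- The pending x_i⁻¹ is either written out, or cancelled by the leading x_i of the image of
x_i^{±1}, which leaves x_{i+1}^{±1}. The third possibility, cancellation against the image of
x_{i+1}, is excluded by the hypothesis. -/
theorem headCode_transduce_true (i : ℕ) : ∀ {w : List (ℕ × Bool)}, RedFrom (2 * i + 3) w →
    headCode (transduce i true w) = 2 * i + 2 ∨ headCode (transduce i true w) = 2 * i + 3 ∨
      headCode (transduce i true w) = 2 * i + 4
  | [], _ => by simp [transduce, headCode, code]
  | (j, e) :: w, h => by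
    have h1 := h.1
    by_cases h2 : j = i
    · subst h2; cases e <;> simp [transduce, headCode, code] <;> omega
    by_cases h3 : j = i + 1
    · subst h3; cases e <;> simp_all [transduce, headCode, code]
      omega
    · cases e <;> simp [transduce, headCode, code, h2, h3]

theorem headCode_transduce_false (i : ℕ) : ∀ {w : List (ℕ × Bool)}, RedFrom (2 * i + 4) w →
    headCode (transduce i false w) ≤ 2 * i + 1 ∨ 2 * i + 5 ≤ headCode (transduce i false w)
  | [], _ => by simp [transduce, headCode]
  | (j, e) :: w, h => by
    have h1 := h.1
    by_cases h2 : j = i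
    · subst h2; cases e <;> simp [transduce, headCode, code]
    by_cases h3 : j = i + 1
    · subst h3; cases e <;> simp_all [transduce, headCode, code]
      omega
    · cases e <;> simp [transduce, headCode, code, h2, h3] <;> omega

/-- The only cancellations between images of consecutive letters involve x_i^{±1}, and delaying
x_i⁻¹ by one state absorbs them. `Compat` is the loop invariant that makes this inductive. -/
theorem redFrom_transduce (i : ℕ) : ∀ {w : List (ℕ × Bool)} {s s' : ℕ} {st : Bool},
    RedFrom s w → Compat i s st s' → RedFrom s' (transduce i st w)
  | [], s, s', st, _, hc => by
    cases st <;> simp_all [transduce, RedFrom, Compat, code, Outer]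
    omega
  | (j, e) :: w, s, s', st, h, hc => by
    obtain ⟨h1, h2⟩ := h
    by_cases hj : j = i
    · subst hj
      have key : RedFrom (codeInv (j + 1, e)) (transduce j true w) :=
        redFrom_transduce j h2 (by cases e <;> simp [Compat, codeInv] <;> omega)
      cases st <;> cases e <;>
        simp_all [transduce, RedFrom, Compat, code, codeInv, Outer] <;> omega
    by_cases hj' : j = i + 1
    · subst hj'
      cases e
      · cases st
        · have key : RedFrom s' (transduce i true w) :=
            redFrom_transduce i h2 (by simp_all [Compat, codeInv, code, Outer]; omega)
          simpa [transduce] using key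
        · have key : RedFrom (2 * i + 1) (transduce i true w) :=
            redFrom_transduce i h2 (by simp_all [Compat, codeInv, code, Outer]; omega)
          simp_all [transduce, RedFrom, code, codeInv, Compat, Outer]
          omega
      · cases st
        · have key : RedFrom (2 * i + 2) (transduce i false w) :=
            redFrom_transduce i h2 (by simp_all [Compat, codeInv, code, Outer]; omega)
          simp_all [transduce, RedFrom, code, codeInv, Compat, Outer]
          omega
        · by_cases hs : s' = 2 * i + 3 ∨ s' = 2 * i + 4
          · have key : RedFrom s' (transduce i false w) :=
              redFrom_transduce i h2 (by simp_all [Compat, codeInv, code, Outer]; omega)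
            simpa [transduce] using key
          · exfalso
            simp_all [Compat, codeInv, code, Outer]
            omega
    · have key : RedFrom (codeInv (j, e)) (transduce i false w) :=
        redFrom_transduce i h2 (by cases e <;> simp [Compat, codeInv, Outer] <;> omega)
      cases st <;> cases e <;>
        simp_all [transduce, RedFrom, Compat, code, codeInv, Outer] <;> omega

end HurwitzOrder

/-! ### Monotonicity of the transducer for the planar order. -/

namespace HurwitzOrder

open FreeGroup

theorem headCode_cons (p : ℕ × Bool) (w : List (ℕ × Bool)) : headCode (p :: w) = code p := rfl

theorem wordLT_of_secondCode {s : ℕ} {p : ℕ × Bool} {w w' : List (ℕ × Bool)}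
    (h : Cyc (codeInv p) (headCode w) (headCode w')) : WordLT s (p :: w) (p :: w') :=
  wordLT_cons (wordLT_of_headCode h)

/-- Words that part at their first letter have outputs that part at the first or second letter, so
comparing cyclic positions settles every case. -/
theorem wordLT_transduce_of_headCode {i s s' : ℕ} {st : Bool} {w w' : List (ℕ × Bool)}
    (hw : RedFrom s w) (hw' : RedFrom s w') (hc : Compat i s st s')
    (h : Cyc s (headCode w) (headCode w')) :
    WordLT s' (transduce i st w) (transduce i st w') := by
  -- Five types of input head: x_i, x_i⁻¹, x_{i+1}, x_{i+1}⁻¹, and everything else, including the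
  -- end of the word at position 0. Each determines enough of the start of the output.
  have shape : ∀ {v : List (ℕ × Bool)}, RedFrom s v →
      (headCode v = 2 * i + 1 ∧ ∃ t, transduce i st v =
        (if st then [] else [(i, true)]) ++ (i + 1, true) :: t) ∨
      (headCode v = 2 * i + 2 ∧ ∃ t, transduce i st v =
        (if st then [] else [(i, true)]) ++ (i + 1, false) :: t) ∨
      (headCode v = 2 * i + 3 ∧ ∃ t, (headCode t ≤ 2 * i + 1 ∨ 2 * i + 5 ≤ headCode t) ∧
        transduce i st v = (if st then [] else [(i, true)]) ++ t) ∨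
      (headCode v = 2 * i + 4 ∧ ∃ t, (headCode t = 2 * i + 2 ∨ headCode t = 2 * i + 3 ∨
        headCode t = 2 * i + 4) ∧ transduce i st v = (if st then [(i, false)] else []) ++ t) ∨
      (Outer i (headCode v) ∧ ∃ t, headCode t = headCode v ∧
        transduce i st v = (if st then [(i, false)] else []) ++ t) := by
    intro v hv
    rcases v with - | ⟨⟨j, e⟩, v⟩
    · exact Or.inr (Or.inr (Or.inr (Or.inr ⟨by simp [Outer, headCode], [], rfl, by
        cases st <;> simp [transduce]⟩)))
    by_cases hj : j = i
    · subst hj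
      cases e
      · exact Or.inr (Or.inl ⟨by simp [headCode, code], transduce j true v, by simp [transduce]⟩)
      · exact Or.inl ⟨by simp [headCode, code], transduce j true v, by simp [transduce]⟩
    by_cases hj' : j = i + 1
    · subst hj'
      cases e
      · exact Or.inr (Or.inr (Or.inr (Or.inl ⟨by simp [headCode, code]; omega, _,
          headCode_transduce_true i (w := v) (by simpa [codeInv, mul_add, add_assoc] using hv.2),
          by simp [transduce]⟩)))
      · exact Or.inr (Or.inr (Or.inl ⟨by simp [headCode, code]; omega, _,
          headCode_transduce_false i (w := v) (by simpa [codeInv, mul_add, add_assoc] using hv.2),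
          by simp [transduce]⟩))
    · refine Or.inr (Or.inr (Or.inr (Or.inr ⟨?_, (j, e) :: transduce i false v, rfl, by
        simp [transduce, hj, hj']⟩)))
      cases e <;> simp [headCode, code, Outer] <;> omega
  have hws : headCode w ≠ s ∨ (w = []) := by
    cases w with
    | nil => exact Or.inr rfl
    | cons p w => exact Or.inl hw.1
  rcases shape hw with ⟨h1, t, e1⟩ | ⟨h1, t, e1⟩ | ⟨h1, t, ht, e1⟩ | ⟨h1, t, ht, e1⟩ | ⟨h1, t, ht, e1⟩ <;>
  rcases shape hw' with ⟨h2, u, e2⟩ | ⟨h2, u, e2⟩ | ⟨h2, u, hu, e2⟩ | ⟨h2, u, hu, e2⟩ | ⟨h2, u, hu, e2⟩ <;>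
  rw [e1, e2] <;> cases st <;>
  simp only [Bool.false_eq_true, if_true, if_false, List.nil_append, List.cons_append] <;>
  simp only [Compat, Outer, Cyc, Bool.false_eq_true, false_and, true_and, false_or, or_false,
    reduceCtorEq] at hc h h1 h2 <;>
  first
  | (exfalso; omega)
  | (apply wordLT_of_headCode; simp only [headCode_cons, code, Cyc, if_true, if_false,
      Bool.false_eq_true]; omega)
  | (apply wordLT_of_secondCode; simp only [headCode_cons, codeInv, code, Cyc, if_true, if_false,
      Bool.false_eq_true]; omega)

/-- A common first letter produces the same output and the same new state for both words, and
`Compat` persists; so only the place where the words part matters. -/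
theorem wordLT_transduce {i : ℕ} : ∀ {w w' : List (ℕ × Bool)} {s s' : ℕ} {st : Bool},
    RedFrom s w → RedFrom s w' → Compat i s st s' → WordLT s w w' →
    WordLT s' (transduce i st w) (transduce i st w')
  | [], [], _, _, _, _, _, _, h => h.elim
  | [], _ :: _, _, _, _, hw, hw', hc, h => wordLT_transduce_of_headCode hw hw' hc h
  | _ :: _, [], _, _, _, hw, hw', hc, h => wordLT_transduce_of_headCode hw hw' hc h
  | (j, e) :: w, q :: w', s, s', st, hw, hw', hc, h => by
    rcases h with ⟨rfl, h⟩ | h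
    swap
    · exact wordLT_transduce_of_headCode hw hw' hc h
    have h1 := hw.1
    by_cases hj : j = i
    · subst hj
      have key : WordLT (codeInv (j + 1, e)) (transduce j true w) (transduce j true w') :=
        wordLT_transduce hw.2 hw'.2 (by cases e <;> simp [Compat, codeInv] <;> omega) h
      cases st
      · simpa [transduce] using wordLT_cons (wordLT_cons key)
      · simpa [transduce] using wordLT_cons key
    by_cases hj' : j = i + 1
    · subst hj'
      cases e
      · cases st
        · have key : WordLT s' (transduce i true w) (transduce i true w') :=
            wordLT_transduce hw.2 hw'.2 (by simp_all [Compat, codeInv, code, Outer]; omega) h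
          simpa [transduce] using key
        · have key : WordLT (2 * i + 1) (transduce i true w) (transduce i true w') :=
            wordLT_transduce hw.2 hw'.2 (by simp_all [Compat, codeInv, code, Outer]; omega) h
          simpa [transduce] using wordLT_cons (p := (i, false)) key
      · cases st
        · have key : WordLT (2 * i + 2) (transduce i false w) (transduce i false w') :=
            wordLT_transduce hw.2 hw'.2 (by simp_all [Compat, codeInv, code, Outer]; omega) h
          simpa [transduce] using wordLT_cons (p := (i, true)) key
        · have key : WordLT s' (transduce i false w) (transduce i false w') :=
            wordLT_transduce hw.2 hw'.2 (by
              simp_all [Compat, codeInv, code, Outer]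
              omega) h
          simpa [transduce] using key
    · have key : WordLT (codeInv (j, e)) (transduce i false w) (transduce i false w') :=
        wordLT_transduce hw.2 hw'.2 (by cases e <;> simp [Compat, codeInv, Outer] <;> omega) h
      cases st
      · simpa [transduce, hj, hj'] using wordLT_cons key
      · simpa [transduce, hj, hj'] using wordLT_cons (wordLT_cons key)

/-- A generator moves every word to a smaller or equal one. The second part is the invariant for
words which are preceded by `(x (i + 1))⁻¹`. -/
theorem transduce_le {i : ℕ} : ∀ (w : List (ℕ × Bool)),
    (∀ s, Outer i s ∨ s = 2 * i + 4 → RedFrom s w →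
      transduce i false w = w ∨ WordLT s (transduce i false w) w) ∧
    (RedFrom (2 * i + 1) w → transduce i true w = (i, false) :: w ∨
      WordLT (2 * i + 3) (transduce i true w) ((i, false) :: w))
  | [] => ⟨fun _ _ _ => Or.inl rfl, fun _ => Or.inl rfl⟩
  | (j, e) :: w => by
    have cons_le : ∀ {s : ℕ} {p : ℕ × Bool} {u v : List (ℕ × Bool)},
        (u = v ∨ WordLT (codeInv p) u v) → (p :: u = p :: v ∨ WordLT s (p :: u) (p :: v)) := by
      rintro s p u v (rfl | h)
      · exact Or.inl rfl
      · exact Or.inr (wordLT_cons h)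
    by_cases hj : j = i
    · subst hj
      cases e
      · refine ⟨fun s hs hr => Or.inr (wordLT_of_headCode ?_),
          fun hr => Or.inr (wordLT_of_headCode ?_)⟩
        · simp [transduce, headCode_cons, code, Cyc, Outer] at hs ⊢; omega
        · simp [transduce, headCode_cons, code, Cyc]; omega
      · refine ⟨fun s hs hr => ?_, fun hr => (hr.1 (by simp [code])).elim⟩
        have hr2 := hr.2
        suffices h : (j + 1, true) :: transduce j true w = w ∨
            WordLT (codeInv (j, true)) ((j + 1, true) :: transduce j true w) w by
          simpa [transduce] using cons_le (s := s) h
        rcases w with - | ⟨⟨k, f⟩, w⟩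
        · right; apply wordLT_of_headCode; simp [headCode, code, codeInv, Cyc]; omega
        -- The output starts with x_j x_{j+1}. Only an input starting the same way requires
        -- recursion; otherwise the second letter decides.
        by_cases hk : k = j + 1 ∧ f = true
        · obtain ⟨rfl, rfl⟩ := hk
          have ih := (transduce_le (i := j) w).1 (2 * j + 4) (Or.inr rfl)
            (by simpa [codeInv, mul_add, add_assoc] using hr2.2)
          have h' : codeInv (j + 1, true) = 2 * j + 4 := by simp [codeInv]; omega
          simpa [transduce] using cons_le (p := (j + 1, true)) (h' ▸ ih)
        · right; apply wordLT_of_headCode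
          have := hr2.1
          cases f <;> simp [headCode, code, codeInv, Cyc] at hk this ⊢ <;> omega
    by_cases hj' : j = i + 1
    · subst hj'
      cases e
      · have step : ∀ s, RedFrom (2 * i + 3) w → (s = 2 * i + 1 ∨ Outer i s) →
            (transduce i true w = (i + 1, false) :: w ∨
              WordLT s (transduce i true w) ((i + 1, false) :: w)) := by
          intro s hr hs
          -- The input x_{i+1}⁻¹ x_i⁻¹ w' has an output that again starts with x_{i+1}⁻¹; what
          -- remains to be compared is exactly the second invariant.
          by_cases hw : ∃ w', w = (i, false) :: w'
          · obtain ⟨w', rfl⟩ := hw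
            have ih := (transduce_le (i := i) w').2 (by simpa [codeInv] using hr.2)
            have h' : codeInv (i + 1, false) = 2 * i + 3 := by simp [codeInv]; omega
            simpa [transduce] using cons_le (p := (i + 1, false)) (s := s) (h' ▸ ih)
          · right; apply wordLT_of_headCode
            have h1 : headCode (transduce i true w) = 2 * i + 2 ∨
                headCode (transduce i true w) = 2 * i + 3 := by
              rcases w with - | ⟨⟨k, f⟩, w⟩
              · simp [transduce, headCode, code]
              have := hr.1
              by_cases hk : k = i
              · subst hk; cases f <;> simp_all [transduce, headCode, code]; omega
              by_cases hk' : k = i + 1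
              · subst hk'; cases f <;> simp_all [transduce, headCode, code]; omega
              · simp [transduce, headCode, code, hk, hk']
            simp only [headCode_cons, code, Cyc, Outer, Bool.false_eq_true, if_false] at hs ⊢
            omega
        refine ⟨fun s hs hr => ?_, fun hr => ?_⟩
        · have h1 := hr.1
          have := step s (by simpa [codeInv, mul_add, add_assoc] using hr.2)
            (by simp only [code, Outer, Bool.false_eq_true, if_false] at h1 hs ⊢; omega)
          simpa [transduce] using this
        · have := step (2 * i + 1) (by simpa [codeInv, mul_add, add_assoc] using hr.2)
            (Or.inl rfl)
          simpa [transduce] using cons_le (p := (i, false)) (by simpa [codeInv] using this)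
      · refine ⟨fun s hs hr => Or.inr (wordLT_of_headCode ?_),
          fun hr => Or.inr (wordLT_of_headCode ?_)⟩
        · simp [transduce, headCode_cons, code, Cyc, Outer] at hs ⊢; omega
        · have := headCode_transduce_false i (w := w)
            (by simpa [codeInv, mul_add, add_assoc] using hr.2)
          simp [transduce, headCode_cons, code, Cyc]; omega
    · have step : (j, e) :: transduce i false w = (j, e) :: w ∨
          ∀ s, WordLT s ((j, e) :: transduce i false w) ((j, e) :: w) ∨ ¬ RedFrom s ((j, e) :: w) := by
        by_cases hr : RedFrom (codeInv (j, e)) w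
        · rcases (transduce_le (i := i) w).1 (codeInv (j, e))
            (by cases e <;> simp [codeInv, Outer] <;> omega) hr with h | h
          · exact Or.inl (by rw [h])
          · exact Or.inr fun s => Or.inl (wordLT_cons h)
        · exact Or.inr fun s => Or.inr fun h => hr h.2
      refine ⟨fun s hs hr => ?_, fun hr => ?_⟩
      · rcases step with h | h
        · left; simpa [transduce, hj, hj'] using h
        · right; simpa [transduce, hj, hj'] using (h s).resolve_right (fun h => h hr)
      · rcases step with h | h
        · left; simpa [transduce, hj, hj'] using h
        · right
          have := (h (2 * i + 1)).resolve_right (fun h => h hr)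
          simpa [transduce, hj, hj'] using
            wordLT_cons (p := (i, false)) (by simpa [codeInv] using this)

end HurwitzOrder

/-! ### The Hurwitz automorphisms and the invariant order on the free group. -/

namespace HurwitzOrder

open FreeGroup

theorem redFrom_of_isReduced : ∀ {w : List (ℕ × Bool)} {s : ℕ}, IsReduced w →
    (w ≠ [] → headCode w ≠ s) → RedFrom s w
  | [], _, _, _ => trivial
  | [p], s, _, hs => ⟨hs (by simp), trivial⟩
  | p :: q :: w, s, h, hs => by
    refine ⟨hs (by simp), redFrom_of_isReduced (isReduced_cons_cons.1 h).2 fun _ => ?_⟩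
    have := (isReduced_cons_cons.1 h).1
    obtain ⟨i, a⟩ := p
    obtain ⟨j, b⟩ := q
    intro h'
    cases a <;> cases b <;> simp [headCode, code, codeInv] at h' this <;> omega

theorem isReduced_of_redFrom : ∀ {w : List (ℕ × Bool)} {s : ℕ}, RedFrom s w → IsReduced w
  | [], _, _ => IsReduced.nil
  | [p], s, _ => IsReduced.singleton
  | p :: q :: w, s, h => by
    refine isReduced_cons_cons.2 ⟨fun e => ?_, isReduced_of_redFrom h.2⟩
    have := h.2.1
    obtain ⟨i, a⟩ := p
    obtain ⟨j, b⟩ := q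
    cases a <;> cases b <;> simp_all [code, codeInv]

theorem redFrom_toWord (g : FreeGroup ℕ) : RedFrom 0 g.toWord := by
  refine redFrom_of_isReduced isReduced_toWord fun h => ?_
  obtain ⟨p, w, e⟩ := List.exists_cons_of_ne_nil h
  rw [e]
  exact (code_pos p).ne'

/-- The homomorphism of the free group underlying the action of an Artin generator. -/
def hurwitzHom (i : ℕ) : FreeGroup ℕ →* FreeGroup ℕ :=
  FreeGroup.lift fun j => if j = i then of i * of (i + 1) * (of i)⁻¹
    else if j = i + 1 then of i else of j

/-- The inverse of `hurwitzHom`. -/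
def hurwitzInvHom (i : ℕ) : FreeGroup ℕ →* FreeGroup ℕ :=
  FreeGroup.lift fun j => if j = i then of (i + 1)
    else if j = i + 1 then (of (i + 1))⁻¹ * of i * of (i + 1) else of j

/-- The automorphism of the free group by which an Artin generator acts. -/
def hurwitz (i : ℕ) : MulAut (FreeGroup ℕ) :=
  MonoidHom.toMulEquiv (hurwitzHom i) (hurwitzInvHom i)
    (by
      ext j
      by_cases h : j = i
      · simp [hurwitzHom, hurwitzInvHom, h, mul_assoc]
      by_cases h' : j = i + 1
      · simp [hurwitzHom, hurwitzInvHom, h']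
      · simp [hurwitzHom, hurwitzInvHom, h, h'])
    (by
      ext j
      by_cases h : j = i
      · simp [hurwitzHom, hurwitzInvHom, h]
      by_cases h' : j = i + 1
      · simp [hurwitzHom, hurwitzInvHom, h', mul_assoc]
      · simp [hurwitzHom, hurwitzInvHom, h, h'])

theorem hurwitz_of (i j : ℕ) : hurwitz i (of j) = if j = i then of i * of (i + 1) * (of i)⁻¹
    else if j = i + 1 then of i else of j := by
  simp [hurwitz, hurwitzHom]

@[simp]
theorem hurwitz_of_self (i : ℕ) : hurwitz i (of i) = of i * of (i + 1) * (of i)⁻¹ := by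
  simp [hurwitz_of]

@[simp]
theorem hurwitz_of_succ (i : ℕ) : hurwitz i (of (i + 1)) = of i := by
  simp [hurwitz_of]

theorem hurwitz_of_ne {i j : ℕ} (h : j ≠ i) (h' : j ≠ i + 1) : hurwitz i (of j) = of j := by
  simp [hurwitz_of, h, h']

theorem mulAut_ext {φ ψ : MulAut (FreeGroup ℕ)} (h : ∀ j, φ (of j) = ψ (of j)) : φ = ψ := by
  have : φ.toMonoidHom = ψ.toMonoidHom := FreeGroup.ext_hom _ _ h
  exact MulEquiv.ext fun x => DFunLike.congr_fun this x

theorem hurwitz_comm {i j : ℕ} (h : i + 2 ≤ j) : hurwitz i * hurwitz j = hurwitz j * hurwitz i := by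
  refine mulAut_ext fun k => ?_
  simp only [MulAut.mul_apply]
  have hij : i ≠ j := by omega
  have e1 : hurwitz j (of i) = of i := hurwitz_of_ne (by omega) (by omega)
  have e2 : hurwitz j (of (i + 1)) = of (i + 1) := hurwitz_of_ne (by omega) (by omega)
  have e3 : hurwitz i (of j) = of j := hurwitz_of_ne (by omega) (by omega)
  have e4 : hurwitz i (of (j + 1)) = of (j + 1) := hurwitz_of_ne (by omega) (by omega)
  rcases eq_or_ne k i with rfl | h1
  · simp [e1, e2]
  rcases eq_or_ne k (i + 1) with rfl | h2
  · simp [e1, e2]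
  rcases eq_or_ne k j with rfl | h3
  · simp [e3, e4]
  rcases eq_or_ne k (j + 1) with rfl | h4
  · simp [e3, e4]
  · simp [hurwitz_of_ne h1 h2, hurwitz_of_ne h3 h4]

theorem hurwitz_braid (i : ℕ) : hurwitz i * hurwitz (i + 1) * hurwitz i =
    hurwitz (i + 1) * hurwitz i * hurwitz (i + 1) := by
  refine mulAut_ext fun k => ?_
  simp only [MulAut.mul_apply]
  have e1 : hurwitz (i + 1) (of i) = of i := hurwitz_of_ne (by omega) (by omega)
  have e2 : hurwitz i (of (i + 1 + 1)) = of (i + 1 + 1) := hurwitz_of_ne (by omega) (by omega)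
  rcases eq_or_ne k i with rfl | h1
  · simp [e1, e2, mul_assoc]
  rcases eq_or_ne k (i + 1) with rfl | h2
  · simp [e1, e2, mul_assoc]
  rcases eq_or_ne k (i + 1 + 1) with rfl | h3
  · simp [e1, e2]
  · simp [hurwitz_of_ne h1 h2, hurwitz_of_ne h2 h3]

theorem mk_transduce (i : ℕ) : ∀ (st : Bool) (w : List (ℕ × Bool)),
    mk (transduce i st w) = (if st then (of i)⁻¹ else 1) * hurwitz i (mk w)
  | st, [] => by
    cases st
    · simp [transduce, ← one_eq_mk]
    · simp [transduce, ← one_eq_mk, of, inv_mk, invRev]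
  | st, (j, e) :: w => by
    have cons : ∀ (p : ℕ × Bool) (v : List (ℕ × Bool)),
        mk (p :: v) = (if p.2 then of p.1 else (of p.1)⁻¹) * mk v := by
      rintro ⟨k, f⟩ v
      cases f <;> simp [of, inv_mk, invRev, mul_mk]
    have ih1 := mk_transduce i true w
    have ih2 := mk_transduce i false w
    simp only [if_true, Bool.false_eq_true, if_false, one_mul] at ih1 ih2
    rw [cons, _root_.map_mul]
    by_cases hj : j = i
    · subst hj
      cases e <;> cases st <;> simp [transduce, cons, ih1, mul_assoc]
    by_cases hj' : j = i + 1
    · subst hj'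
      cases e <;> cases st <;> simp [transduce, cons, ih1, ih2]
    · cases e <;> cases st <;>
        simp [transduce, hj, hj', cons, ih2, hurwitz_of_ne hj hj']

/-- The output represents the image by `mk_transduce` and is reduced by `redFrom_transduce`, so
facts about the transducer become facts about the automorphism. -/
theorem toWord_hurwitz (i : ℕ) (g : FreeGroup ℕ) :
    (hurwitz i g).toWord = transduce i false g.toWord := by
  have h1 := mk_transduce i false g.toWord
  simp only [Bool.false_eq_true, if_false, one_mul, mk_toWord] at h1
  rw [← h1, toWord_mk]
  exact (isReduced_of_redFrom (s := 0) (redFrom_transduce i (redFrom_toWord g)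
    (by simp [Compat, Outer]))).reduce_eq

/-- The planar order on the nontrivial elements of the free group. -/
def FreeLT (g h : FreeGroup ℕ) : Prop := WordLT 0 g.toWord h.toWord

theorem FreeLT.trans {g h k : FreeGroup ℕ} (h1 : FreeLT g h) (h2 : FreeLT h k) : FreeLT g k :=
  wordLT_trans h1 h2

theorem FreeLT.irrefl (g : FreeGroup ℕ) : ¬ FreeLT g g := wordLT_irrefl

theorem FreeLT.asymm {g h : FreeGroup ℕ} (h1 : FreeLT g h) (h2 : FreeLT h g) : False :=
  FreeLT.irrefl g (h1.trans h2)

theorem FreeLT.left_ne_one {g h : FreeGroup ℕ} (h1 : FreeLT g h) : g ≠ 1 := by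
  rintro rfl
  unfold FreeLT at h1
  cases h : h.toWord <;> simp [h, WordLT, Cyc] at h1

theorem FreeLT.right_ne_one {g h : FreeGroup ℕ} (h1 : FreeLT g h) : h ≠ 1 := by
  rintro rfl
  unfold FreeLT at h1
  cases h : g.toWord <;> simp [h, WordLT, Cyc] at h1

theorem freeLT_trichotomy {g h : FreeGroup ℕ} (hg : g ≠ 1) (hh : h ≠ 1) :
    FreeLT g h ∨ g = h ∨ FreeLT h g := by
  have := wordLT_trichotomy (redFrom_toWord g) (redFrom_toWord h)
    (fun e => (hg (toWord_eq_nil_iff.1 e)).elim) (fun e => (hh (toWord_eq_nil_iff.1 e)).elim)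
  rwa [toWord_inj] at this

theorem freeLT_hurwitz {g h : FreeGroup ℕ} (i : ℕ) (H : FreeLT g h) :
    FreeLT (hurwitz i g) (hurwitz i h) := by
  unfold FreeLT
  rw [toWord_hurwitz, toWord_hurwitz]
  exact wordLT_transduce (redFrom_toWord g) (redFrom_toWord h) (by simp [Compat, Outer]) H

/-- The order preserving automorphisms of the free group. -/
def orderAut : Subgroup (MulAut (FreeGroup ℕ)) where
  carrier := {φ | ∀ g h, FreeLT (φ g) (φ h) ↔ FreeLT g h}
  mul_mem' {φ ψ} hφ hψ g h := by
    rw [MulAut.mul_apply, MulAut.mul_apply, hφ, hψ]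
  one_mem' _ _ := Iff.rfl
  inv_mem' {φ} hφ g h := by
    rw [← hφ, MulAut.apply_inv_self, MulAut.apply_inv_self]

/-- A strictly increasing map of a linear order also reflects the order. -/
theorem hurwitz_mem_orderAut (i : ℕ) : hurwitz i ∈ orderAut := by
  refine fun g h => ⟨fun H => ?_, freeLT_hurwitz i⟩
  have hg : g ≠ 1 := fun e => H.left_ne_one (by rw [e, _root_.map_one])
  have hh : h ≠ 1 := fun e => H.right_ne_one (by rw [e, _root_.map_one])
  rcases freeLT_trichotomy hg hh with h' | rfl | h'
  · exact h'
  · exact (FreeLT.irrefl _ H).elim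
  · exact (H.asymm (freeLT_hurwitz i h')).elim

theorem hurwitz_le (i : ℕ) (g : FreeGroup ℕ) : hurwitz i g = g ∨ FreeLT (hurwitz i g) g := by
  have := (transduce_le (i := i) g.toWord).1 0 (by simp [Outer]) (redFrom_toWord g)
  rwa [← toWord_hurwitz, toWord_inj] at this

/-- The reduced word of `g` starts with the generator `x 0`. -/
def StartsZero (g : FreeGroup ℕ) : Prop := g.toWord.head? = some (0, true)

/-- The letter x_0 has the lowest position at the root. There is no converse: x_0² starts with x_0
and still lies above x_0. -/
theorem freeLT_of_zero {g : FreeGroup ℕ} (hg : g ≠ 1) (h : ¬ StartsZero g) : FreeLT (of 0) g := by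
  unfold StartsZero at h
  unfold FreeLT
  rw [toWord_of]
  rcases hw : g.toWord with - | ⟨⟨j, e⟩, w⟩
  · exact (hg (toWord_eq_nil_iff.1 hw)).elim
  · apply wordLT_of_headCode
    rw [hw] at h
    cases e
    · simp [headCode, code, Cyc]
    · simp only [List.head?_cons, Option.some.injEq, Prod.mk.injEq, and_true] at h
      simp [headCode, code, Cyc]; omega

theorem startsZero_of_freeLT {g : FreeGroup ℕ} (h : FreeLT g (of 0)) : StartsZero g := by
  by_contra h'
  exact h.asymm (freeLT_of_zero h.left_ne_one h')

theorem freeLT_hurwitz_of_self (i : ℕ) : FreeLT (hurwitz i (of i)) (of i) := by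
  refine (hurwitz_le i (of i)).resolve_left fun h => ?_
  have := congrArg toWord h
  rw [toWord_hurwitz] at this
  simp [transduce] at this

end HurwitzOrder

/-! ### The action of the braid group on the ordered free group. -/

namespace BraidGroup

open FreeGroup HurwitzOrder

variable {n : ℕ}

/-- The action of the braid group on the free group. -/
def act : BraidGroup n →* MulAut (FreeGroup ℕ) :=
  PresentedGroup.toGroup (f := fun i : Fin (n - 1) => hurwitz i) (by
    rintro r (⟨i, j, h, rfl⟩ | ⟨i, j, h, rfl⟩)
    · simp only [_root_.map_mul, _root_.map_inv, lift_apply_of]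
      rw [hurwitz_comm h, mul_inv_cancel]
    · simp only [_root_.map_mul, _root_.map_inv, lift_apply_of]
      rw [← h, hurwitz_braid, mul_inv_cancel])

@[simp]
theorem act_gen (i : Fin (n - 1)) : act (gen i) = hurwitz i := PresentedGroup.toGroup.of _

/-- The Artin generators, indexed by natural numbers; the value is `1` out of range. -/
def sgen (n i : ℕ) : BraidGroup n := if h : i < n - 1 then gen ⟨i, h⟩ else 1

theorem sgen_eq_gen (i : Fin (n - 1)) : sgen n i = gen i := by simp [sgen]

theorem act_sgen {i : ℕ} (h : i < n - 1) : act (sgen n i) = hurwitz i := by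
  simp [sgen, h]

theorem sgen_comm {i j : ℕ} (h : i + 2 ≤ j) : sgen n i * sgen n j = sgen n j * sgen n i := by
  unfold sgen
  split_ifs with h1 h2 <;> try simp
  have : PresentedGroup.mk (braidRels n) ((FreeGroup.of ⟨i, h1⟩ * FreeGroup.of ⟨j, h2⟩) *
      (FreeGroup.of ⟨j, h2⟩ * FreeGroup.of ⟨i, h1⟩)⁻¹) = 1 :=
    PresentedGroup.one_of_mem (Or.inl ⟨_, _, h, rfl⟩)
  rw [_root_.map_mul, _root_.map_inv, mul_inv_eq_one] at this
  simp only [_root_.map_mul] at this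
  exact this

theorem sgen_braid {i : ℕ} (h : i + 1 < n - 1) : sgen n i * sgen n (i + 1) * sgen n i =
    sgen n (i + 1) * sgen n i * sgen n (i + 1) := by
  have h' : i < n - 1 := by omega
  simp only [sgen, h, h', dite_true]
  have : PresentedGroup.mk (braidRels n) ((FreeGroup.of ⟨i, h'⟩ * FreeGroup.of ⟨i + 1, h⟩ *
      FreeGroup.of ⟨i, h'⟩) * (FreeGroup.of ⟨i + 1, h⟩ * FreeGroup.of ⟨i, h'⟩ *
      FreeGroup.of ⟨i + 1, h⟩)⁻¹) = 1 :=
    PresentedGroup.one_of_mem (Or.inr ⟨_, _, rfl, rfl⟩)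
  rw [_root_.map_mul, _root_.map_inv, mul_inv_eq_one] at this
  simp only [_root_.map_mul] at this
  exact this

theorem mem_of_sgen_mem (H : Subgroup (BraidGroup n)) (h : ∀ i < n - 1, sgen n i ∈ H)
    (β : BraidGroup n) : β ∈ H :=
  PresentedGroup.generated_by _ H (fun j => by
    have := h j j.2
    rwa [sgen_eq_gen] at this) β

theorem act_mem_orderAut (β : BraidGroup n) : act β ∈ orderAut :=
  mem_of_sgen_mem (orderAut.comap act) (fun i hi => by
    rw [Subgroup.mem_comap, act_sgen hi]; exact hurwitz_mem_orderAut i) β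

end BraidGroup

/-! ### Products of conjugates of generators in the free group -/

namespace HurwitzOrder

open FreeGroup

variable {α : Type*}

theorem isReduced_append {A B : List (α × Bool)} (hA : IsReduced A) (hB : IsReduced B)
    (h : ∀ a ∈ A.getLast?, ∀ b ∈ B.head?, a.1 = b.1 → a.2 = b.2) : IsReduced (A ++ B) :=
  List.isChain_append.2 ⟨hA, hB, h⟩

theorem getLast?_invRev (A : List (α × Bool)) :
    (invRev A).getLast? = A.head?.map fun p => (p.1, !p.2) := by
  cases A <;> simp [invRev]

theorem head?_invRev (A : List (α × Bool)) :
    (invRev A).head? = A.getLast?.map fun p => (p.1, !p.2) := by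
  simp [invRev]

theorem isReduced_map_true : ∀ L : List α, FreeGroup.IsReduced (L.map fun j => (j, true))
  | [] => IsReduced.nil
  | [_] => IsReduced.singleton
  | _ :: _ :: L => isReduced_cons_cons.2 ⟨fun _ => rfl, isReduced_map_true (_ :: L)⟩

variable [DecidableEq α]

theorem toWord_mk_of_isReduced {A : List (α × Bool)} (hA : IsReduced A) : (mk A).toWord = A := by
  rw [toWord_mk, hA.reduce_eq]

/-- If the first letter of `g` is lost in `g * h`, then `h` must have cancelled all of `g`: the word
of `g⁻¹` ends in the inverse of `y`, so nothing cancels between it and `g * h`. -/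
theorem toWord_eq_of_head?_mul_ne {g h : FreeGroup α} {y : α × Bool}
    (hg : g.toWord.head? = some y) (hgh : (g * h).toWord.head? ≠ some y) :
    h.toWord = (g⁻¹).toWord ++ (g * h).toWord := by
  have hr : IsReduced ((g⁻¹).toWord ++ (g * h).toWord) := by
    refine isReduced_append isReduced_toWord isReduced_toWord fun a ha b hb hab => ?_
    rw [toWord_inv, getLast?_invRev, hg] at ha
    simp only [Option.map_some, Option.mem_def, Option.some.injEq] at ha hb
    subst ha
    rw [hb] at hgh
    obtain ⟨i, e⟩ := y
    obtain ⟨j, f⟩ := b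
    simp only [ne_eq, Option.some.injEq, Prod.mk.injEq, not_and] at hgh hab ⊢
    have := hgh hab.symm
    cases e <;> cases f <;> simp_all
  calc h.toWord = (g⁻¹ * (g * h)).toWord := by rw [inv_mul_cancel_left]
    _ = _ := by rw [toWord_mul, hr.reduce_eq]

theorem exists_common_prefix : ∀ u v : List (α × Bool), ∃ c r s, u = c ++ r ∧ v = c ++ s ∧
    ∀ p ∈ r.head?, p ∉ s.head?
  | [], v => ⟨[], [], v, rfl, rfl, by simp⟩
  | p :: u, [] => ⟨[], p :: u, [], rfl, rfl, by simp⟩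
  | p :: u, q :: v => by
    by_cases h : p = q
    · obtain ⟨c, r, s, rfl, rfl, hd⟩ := exists_common_prefix u v
      exact ⟨p :: c, r, s, rfl, by rw [h]; rfl, hd⟩
    · exact ⟨[], p :: u, q :: v, rfl, rfl, by simpa using fun e => h e.symm⟩

/-- If a conjugate of a generator is multiplied by an element and neither of the two distinguished
letters is cancelled, then the product starts like the conjugate. -/
theorem exists_toWord_mul_eq {a Q : FreeGroup α} {u u' q : List (α × Bool)} {k k' : α} {e : Bool}
    (ha : a.toWord = u ++ (k, e) :: invRev u) (hQ : Q.toWord = u' ++ (k', e) :: q)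
    (h1 : ¬ u ++ [(k, !e)] <+: u') (h2 : ¬ u' ++ [(k', e)] <+: u) :
    ∃ q', (a * Q).toWord = u ++ (k, e) :: q' := by
  obtain ⟨c, r, s, rfl, rfl, hd⟩ := exists_common_prefix u u'
  refine ⟨invRev r ++ (s ++ (k', e) :: q), ?_⟩
  have hra : IsReduced (c ++ r ++ (k, e) :: invRev (c ++ r)) := ha ▸ isReduced_toWord
  have hrQ : IsReduced (c ++ s ++ (k', e) :: q) := hQ ▸ isReduced_toWord
  have hred : IsReduced (c ++ r ++ [(k, e)] ++ (invRev r ++ (s ++ (k', e) :: q))) := by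
    refine IsReduced.append_overlap (hra.infix ⟨[], invRev (c ++ r), by simp⟩) ?_ (by simp)
    rw [← List.append_assoc]
    refine isReduced_append (hra.infix ⟨c ++ r, invRev c, by simp⟩)
      (hrQ.infix ⟨c, [], by simp⟩) ?_
    -- If both remainders are nonempty, they start differently and nothing cancels. An empty `r` or
    -- `s` exposes a distinguished letter, which `h1` or `h2` protects; if both are empty, the two
    -- distinguished letters have the same sign.
    rcases r with - | ⟨p, r⟩ <;> rcases s with - | ⟨p', s⟩
    · simp
    · simp only [invRev_empty, List.append_nil, List.getLast?_singleton, List.cons_append,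
        List.head?_cons, Option.mem_def, Option.some.injEq, forall_eq']
      intro hk
      by_contra hne
      refine h1 ⟨s, ?_⟩
      have : p' = (k, !e) := by
        obtain ⟨j, f⟩ := p'
        simp only at hk hne
        subst hk
        cases e <;> cases f <;> simp_all
      simp [this]
    · have : ([(k, e)] ++ invRev (p :: r)).getLast? = some (p.1, !p.2) := by
        rw [List.getLast?_append, getLast?_invRev]; simp
      simp only [this, List.nil_append, List.head?_cons, Option.mem_def, Option.some.injEq,
        forall_eq']
      intro hk
      by_contra hne
      refine h2 ⟨r, ?_⟩
      have : p = (k', e) := by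
        obtain ⟨j, f⟩ := p
        simp only at hk hne
        subst hk
        cases e <;> cases f <;> simp_all
      simp [this]
    · have : ([(k, e)] ++ invRev (p :: r)).getLast? = some (p.1, !p.2) := by
        rw [List.getLast?_append, getLast?_invRev]; simp
      simp only [List.head?_cons, Option.mem_def, Option.some.injEq, forall_eq'] at hd
      rw [this]
      simp only [List.cons_append, List.head?_cons, Option.mem_def, Option.some.injEq, forall_eq']
      intro hk
      obtain ⟨j, f⟩ := p
      obtain ⟨j', f'⟩ := p'
      obtain rfl : j = j' := hk
      cases f <;> cases f' <;> simp_all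
  have heq : a * Q = mk (c ++ r ++ [(k, e)] ++ (invRev r ++ (s ++ (k', e) :: q))) := by
    rw [← mk_toWord (x := a), ← mk_toWord (x := Q), ha, hQ]
    have hcons : ∀ (p : α × Bool) (l : List (α × Bool)), p :: l = [p] ++ l := fun _ _ => rfl
    rw [hcons _ (invRev (c ++ r)), hcons _ q]
    simp only [invRev_append, ← mul_mk, ← inv_mk]
    group
  rw [heq, toWord_mk_of_isReduced hred]
  simp

/-- Every conjugate of a generator has a palindromic reduced word. -/
theorem exists_toWord_conj (g : FreeGroup α) (k : α) :
    ∃ u, (g * of k * g⁻¹).toWord = u ++ (k, true) :: invRev u := by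
  suffices h : ∀ L : List (α × Bool), IsReduced L →
      ∃ u, (mk L * of k * (mk L)⁻¹).toWord = u ++ (k, true) :: invRev u by
    have := h g.toWord isReduced_toWord
    rwa [mk_toWord] at this
  intro L
  induction L using List.reverseRecOn with
  | nil => exact fun _ => ⟨[], by simp [← one_eq_mk]⟩
  | append_singleton L p ih =>
    intro hL
    -- A final letter x_k^{±1} of the conjugator commutes with x_k and can be dropped.
    by_cases hp : p.1 = k
    · obtain ⟨u, hu⟩ := ih (hL.infix ⟨[], [p], by simp⟩)
      refine ⟨u, ?_⟩
      rw [← hu]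
      congr 1
      obtain ⟨j, e⟩ := p
      simp only at hp
      subst hp
      rw [← mul_mk]
      have : mk [(j, e)] = of j ∨ mk [(j, e)] = (of j)⁻¹ := by
        cases e
        · right; simp [of, inv_mk, invRev]
        · left; rfl
      rcases this with h | h <;> rw [h] <;> group
    · refine ⟨L ++ [p], ?_⟩
      have hred : IsReduced ((L ++ [p]) ++ [(k, true)] ++ invRev (L ++ [p])) := by
        refine IsReduced.append_overlap
          (isReduced_append hL IsReduced.singleton (by simp [hp])) ?_ (by simp)
        refine isReduced_append IsReduced.singleton ?_ ?_
        · rw [isReduced_iff_reduce_eq, reduce_invRev, hL.reduce_eq]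
        · rw [head?_invRev]
          simpa using fun h => (hp h.symm).elim
      have : mk (L ++ [p]) * of k * (mk (L ++ [p]))⁻¹ =
          mk ((L ++ [p]) ++ [(k, true)] ++ invRev (L ++ [p])) := by
        rw [inv_mk, of, mul_mk, mul_mk]
      rw [this, toWord_mk_of_isReduced hred]
      simp

/-- The product `a i * a (i + 1) * ⋯ * a (i + m - 1)`. -/
def seg {G : Type*} [Group G] (a : ℕ → G) : ℕ → ℕ → G
  | _, 0 => 1
  | i, m + 1 => a i * seg a (i + 1) m

section seg

variable {G : Type*} [Group G] (a : ℕ → G)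

theorem seg_zero (i : ℕ) : seg a i 0 = 1 := rfl

theorem seg_succ (i m : ℕ) : seg a i (m + 1) = a i * seg a (i + 1) m := rfl

theorem seg_one (i : ℕ) : seg a i 1 = a i := mul_one _

theorem seg_add (i m m' : ℕ) : seg a i (m + m') = seg a i m * seg a (i + m) m' := by
  induction m generalizing i with
  | zero => simp [seg_zero]
  | succ m ih =>
    rw [Nat.succ_add, seg_succ, seg_succ, ih, mul_assoc]
    congr 3; omega

theorem seg_succ_right (i m : ℕ) : seg a i (m + 1) = seg a i m * a (i + m) := by
  rw [seg_add, seg_one]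

theorem map_seg {G' : Type*} [Group G'] {F : Type*} [FunLike F G G'] [MonoidHomClass F G G']
    (f : F) (i m : ℕ) : f (seg a i m) = seg (fun j => f (a j)) i m := by
  induction m generalizing i with
  | zero => simp [seg_zero]
  | succ m ih => rw [seg_succ, seg_succ, _root_.map_mul, ih]

theorem seg_congr {a b : ℕ → G} {i m : ℕ} (h : ∀ j, i ≤ j → j < i + m → a j = b j) :
    seg a i m = seg b i m := by
  induction m generalizing i with
  | zero => rfl
  | succ m ih =>
    rw [seg_succ, seg_succ, h i le_rfl (by omega), ih fun j h1 h2 => h j (by omega) (by omega)]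

end seg

theorem toWord_seg_of (i m : ℕ) :
    (seg (of : ℕ → FreeGroup ℕ) i m).toWord = (List.range' i m).map fun j => (j, true) := by
  induction m generalizing i with
  | zero => simp [seg_zero]
  | succ m ih =>
    rw [seg_succ, toWord_mul, ih, toWord_of]
    refine IsReduced.reduce_eq ?_
    exact isReduced_map_true (i :: List.range' (i + 1) m)

/-- Neither of the distinguished letters of the arcs `(u t, k t)` and `(u (t + 1), k (t + 1))` is
cancelled in their product. -/
def NoCancel (u : ℕ → List (α × Bool)) (k : ℕ → α) (t : ℕ) : Prop :=
  ¬ u t ++ [(k t, false)] <+: u (t + 1) ∧ ¬ u (t + 1) ++ [(k (t + 1), true)] <+: u t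

section arcs

variable {a : ℕ → FreeGroup α} {u : ℕ → List (α × Bool)} {k : ℕ → α}

/-- Multiply up from the right: by `exists_toWord_mul_eq` each new left factor keeps its initial
half and its middle letter. -/
theorem exists_toWord_seg {i m : ℕ}
    (ha : ∀ t, i ≤ t → t ≤ i + m → (a t).toWord = u t ++ (k t, true) :: invRev (u t))
    (hn : ∀ t, i ≤ t → t < i + m → NoCancel u k t) :
    ∃ q, (seg a i (m + 1)).toWord = u i ++ (k i, true) :: q := by
  induction m generalizing i with
  | zero => exact ⟨_, by rw [seg_one, ha i le_rfl le_rfl]⟩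
  | succ m ih =>
    obtain ⟨q, hq⟩ := ih (i := i + 1) (fun t h1 h2 => ha t (by omega) (by omega))
      (fun t h1 h2 => hn t (by omega) (by omega))
    have := hn i le_rfl (by omega)
    exact exists_toWord_mul_eq (ha i le_rfl (by omega)) hq this.1 this.2

theorem exists_toWord_seg_inv {i m : ℕ}
    (ha : ∀ t, i ≤ t → t ≤ i + m → (a t).toWord = u t ++ (k t, true) :: invRev (u t))
    (hn : ∀ t, i ≤ t → t < i + m → NoCancel u k t) :
    ∃ q, (seg a i (m + 1))⁻¹.toWord = u (i + m) ++ (k (i + m), false) :: q := by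
  have hinv : ∀ t, i ≤ t → t ≤ i + m →
      (a t)⁻¹.toWord = u t ++ (k t, false) :: invRev (u t) := by
    intro t h1 h2
    rw [toWord_inv, ha t h1 h2, invRev_append, invRev_cons, invRev_invRev]
    simp [invRev]
  induction m with
  | zero => exact ⟨_, by rw [seg_one, hinv i le_rfl le_rfl]; rfl⟩
  | succ m ih =>
    obtain ⟨q, hq⟩ := ih (fun t h1 h2 => ha t (by omega) (by omega))
      (fun t h1 h2 => hn t (by omega) (by omega)) (fun t h1 h2 => hinv t (by omega) (by omega))
    have := hn (i + m) (by omega) (by omega)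
    rw [seg_succ_right, mul_inv_rev]
    exact exists_toWord_mul_eq (hinv _ (by omega) (by omega)) hq this.2 this.1

end arcs

end HurwitzOrder

/-! ### Shortening the first of a system of arcs with prescribed product. -/

namespace HurwitzOrder

open FreeGroup

theorem startsZero_inv_iff {g : FreeGroup ℕ} :
    StartsZero g⁻¹ ↔ g.toWord.getLast? = some (0, false) := by
  unfold StartsZero
  rw [toWord_inv, head?_invRev]
  rcases h : g.toWord.getLast? with - | ⟨j, e⟩
  · simp
  · cases e <;> simp

/-- The reduction step for a sequence of arcs with the product `x 0 * ⋯ * x (n - 1)`: if the first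
one starts with `x 0`, then it can be shortened, either by the second arc or by the product of
an initial segment. -/
theorem exists_reduction {n : ℕ} (hn : 2 ≤ n) {a : ℕ → FreeGroup ℕ} {u : ℕ → List (ℕ × Bool)}
    {k : ℕ → ℕ} (ha : ∀ t < n, (a t).toWord = u t ++ (k t, true) :: invRev (u t))
    (hc : ∀ t, 1 ≤ t → t + 1 < n → NoCancel u k t) (hprod : seg a 0 n = seg of 0 n)
    (h0 : (u 0).head? = some (0, true)) :
    u 1 ++ [(k 1, true)] <+: u 0 ∨
      ∃ j z, 2 ≤ j ∧ j ≤ n ∧ u 0 = (seg a 0 j).toWord ++ z ∧ z.head? = some (0, true) ∧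
        seg a 0 j ≠ 1 := by
  rw [or_iff_not_imp_left]
  intro hnot
  have hex : ∃ j, 1 ≤ j ∧ (j = n ∨ (u j).head? ≠ some (0, true)) := ⟨n, by omega, Or.inl rfl⟩
  classical
  -- The arcs before `j` all start with x_0; `j = n` if every arc does. The product is split there
  -- as A * B.
  let j := Nat.find hex
  obtain ⟨hj1, hj⟩ : 1 ≤ j ∧ (j = n ∨ (u j).head? ≠ some (0, true)) := Nat.find_spec hex
  have hjn : j ≤ n := Nat.find_min' hex ⟨by omega, Or.inl rfl⟩
  have hmin : ∀ t < j, (u t).head? = some (0, true) := by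
    intro t ht
    rcases Nat.eq_zero_or_pos t with rfl | ht0
    · exact h0
    · have := Nat.find_min hex ht
      push Not at this
      exact (this ht0).2
  have hcj : j < n → ¬ u j ++ [(k j, true)] <+: u (j - 1) := by
    intro hlt
    rcases Nat.lt_or_ge 1 j with h | h
    · have := (hc (j - 1) (by omega) (by omega)).2
      rwa [Nat.sub_add_cancel hj1] at this
    · have : j = 1 := by omega
      rw [this]; exact hnot
  -- the final segment does not start with `x 0`
  have hB : ¬ StartsZero (seg a j (n - j)) := by
    unfold StartsZero
    rcases Nat.lt_or_ge j n with h | h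
    · obtain ⟨m, hm⟩ : ∃ m, n - j = m + 1 := ⟨n - j - 1, by omega⟩
      obtain ⟨q, hq⟩ := exists_toWord_seg (a := a) (u := u) (k := k) (i := j) (m := m)
        (fun t h1 h2 => ha t (by omega)) (fun t h1 h2 => hc t (by omega) (by omega))
      rw [hm, hq]
      have h1 := hj.resolve_left (by omega)
      have h2 := hcj h
      have h3 := hmin (j - 1) (by omega)
      rcases huj : u j with - | ⟨p, v⟩
      · rw [huj] at h2
        intro h4
        apply h2
        obtain ⟨v, hv⟩ : ∃ v, u (j - 1) = (0, true) :: v := by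
          rcases hv : u (j - 1) with - | ⟨p, v⟩
          · simp [hv] at h3
          · rw [hv] at h3; simp at h3; exact ⟨v, by rw [h3]⟩
        rw [hv]
        simp at h4
        exact ⟨v, by simp [h4]⟩
      · rw [huj] at h1
        simpa using h1
    · have : n - j = 0 := by omega
      simp [this, seg_zero]
  set A := seg a 0 j with hAdef
  set B := seg a j (n - j) with hBdef
  have hAB : A * B = seg of 0 n := by
    rw [← hprod, show n = j + (n - j) by omega, seg_add]
    simp [A, B]
  have hC : ∀ p ∈ (seg of 0 n : FreeGroup ℕ).toWord, p.2 = true := by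
    intro p hp
    rw [toWord_seg_of] at hp
    obtain ⟨i, -, rfl⟩ := List.mem_map.1 hp
    rfl
  -- Otherwise `A` would be an initial segment of the positive word x_0 ⋯ x_{n-1}, although it ends
  -- in x_0⁻¹.
  have hA : ¬ StartsZero A⁻¹ := by
    intro h
    have h1 := toWord_eq_of_head?_mul_ne (g := A⁻¹) (h := seg of 0 n) h (by
      rw [← hAB, inv_mul_cancel_left]; exact hB)
    rw [startsZero_inv_iff] at h
    have h2 := hC (0, false) (by
      rw [h1, inv_inv]
      exact List.mem_append_left _ (List.mem_of_getLast? h))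
    simp at h2
  have hA1 : A ≠ 1 := by
    intro h
    rw [h, one_mul] at hAB
    rw [hAB] at hB
    apply hB
    unfold StartsZero
    rw [toWord_seg_of]
    obtain ⟨m, rfl⟩ : ∃ m, n = m + 1 := ⟨n - 1, by omega⟩
    simp [List.range'_succ]
  have ha0 := ha 0 (by omega)
  -- For `j = 1`, `A` is the first arc, whose inverse does start with x_0.
  have hj2 : 2 ≤ j := by
    by_contra hlt
    have hj' : j = 1 := by omega
    apply hA
    rw [startsZero_inv_iff, hAdef, hj', seg_one, ha0, List.getLast?_append, List.getLast?_cons,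
      getLast?_invRev, h0]
    simp
  -- the initial segment without its first arc
  obtain ⟨m, hm⟩ : ∃ m, j = m + 1 + 1 := ⟨j - 2, by omega⟩
  obtain ⟨q, hq⟩ := exists_toWord_seg (a := a) (u := u) (k := k) (i := 1) (m := m)
    (fun t h1 h2 => ha t (by omega)) (fun t h1 h2 => hc t (by omega) (by omega))
  obtain ⟨q', hq'⟩ := exists_toWord_seg_inv (a := a) (u := u) (k := k) (i := 1) (m := m)
    (fun t h1 h2 => ha t (by omega)) (fun t h1 h2 => hc t (by omega) (by omega))
  set Q := seg a 1 (m + 1) with hQdef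
  have hAQ : A = a 0 * Q := by rw [hAdef, hm, seg_succ]
  have hQ0 : StartsZero Q⁻¹ := by
    unfold StartsZero
    rw [hq', List.head?_append, hmin (1 + m) (by omega)]
    rfl
  -- The product Q⁻¹ a_0⁻¹ = A⁻¹ has lost the initial x_0 of Q⁻¹, so the palindrome a_0⁻¹ is the
  -- concatenation of the words of Q and A⁻¹.
  have key := toWord_eq_of_head?_mul_ne (g := Q⁻¹) (h := (a 0)⁻¹) hQ0 (by
    rw [← mul_inv_rev, ← hAQ]; exact hA)
  rw [← mul_inv_rev, ← hAQ, inv_inv, toWord_inv, ha0, invRev_append, invRev_cons,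
    invRev_invRev] at key
  have key' : u 0 ++ (k 0, false) :: invRev (u 0) = Q.toWord ++ (A⁻¹).toWord := by
    rw [← key]; simp [invRev]
  have hpre : u 1 ++ [(k 1, true)] <+: Q.toWord := ⟨q, by rw [hq]; simp⟩
  have hpre0 : u 0 ++ [(k 0, false)] <+: u 0 ++ (k 0, false) :: invRev (u 0) :=
    ⟨invRev (u 0), by simp⟩
  -- If `Q` ended within `u 0`, then its prefix `u 1 ++ [(k 1, true)]` would be a prefix of `u 0`,
  -- which is the excluded alternative.
  have hlen : (u 0 ++ [(k 0, false)]).length ≤ Q.toWord.length := by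
    by_contra hlt
    have h1 : u 1 ++ [(k 1, true)] <+: u 0 ++ (k 0, false) :: invRev (u 0) := by
      rw [key']; exact hpre.trans (List.prefix_append _ _)
    have h2 := List.IsPrefix.length_le hpre
    simp only [List.length_append, List.length_singleton] at h2 hlt
    exact hnot (List.prefix_of_prefix_length_le h1 (List.prefix_append _ _) (by simp; omega))
  obtain ⟨v, hv⟩ := List.prefix_of_prefix_length_le hpre0
    (key' ▸ List.prefix_append Q.toWord (A⁻¹).toWord) hlen
  have h3 : invRev (u 0) = v ++ (A⁻¹).toWord := by
    rw [← hv] at key'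
    simpa using key'
  -- If `v` is empty, the two prefixes of `Q` end in letters of opposite sign, so the shorter one
  -- again lies inside `u 0`.
  have hv0 : v ≠ [] := by
    rintro rfl
    have h4 : u 1 ++ [(k 1, true)] <+: u 0 ++ [(k 0, false)] := by
      rw [← hv, List.append_nil] at hpre; exact hpre
    have h5 : (u 1 ++ [(k 1, true)]).length < (u 0 ++ [(k 0, false)]).length := by
      refine lt_of_le_of_ne h4.length_le fun h => ?_
      have := h4.eq_of_length h
      have := congrArg List.getLast? this
      simp at this
    simp only [List.length_append, List.length_singleton] at h5
    exact hnot (List.prefix_of_prefix_length_le h4 (List.prefix_append _ _) (by simp; omega))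
  refine ⟨j, invRev v, hj2, hjn, ?_, ?_, hA1⟩
  · have := congrArg invRev h3
    rw [invRev_invRev, invRev_append, toWord_inv, invRev_invRev] at this
    exact this
  · rw [head?_invRev]
    have h6 := startsZero_inv_iff.1 hQ0
    rw [← hv, List.getLast?_append] at h6
    obtain ⟨p, hp⟩ : ∃ p, v.getLast? = some p := by
      rcases hp : v.getLast? with - | p
      · exact (hv0 (List.getLast?_eq_none_iff.1 hp)).elim
      · exact ⟨p, rfl⟩
    rw [hp] at h6 ⊢
    simp at h6
    simp [h6]

end HurwitzOrder

/-! ### The stabilizer of the first generator -/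

namespace BraidGroup

open FreeGroup HurwitzOrder

variable {n : ℕ}

theorem conj_sq_eq_of_braid {G : Type*} [Group G] {x y : G} (h : x * y * x = y * x * y) :
    y * x ^ 2 * y⁻¹ = (x ^ 2)⁻¹ * (x * y ^ 2 * x⁻¹) * x ^ 2 ∧ y * (x * y ^ 2 * x⁻¹) * y⁻¹ = x ^ 2 := by
  have h1 : y * x * y⁻¹ = x⁻¹ * y * x := by
    rw [mul_inv_eq_iff_eq_mul, mul_assoc, mul_assoc, ← mul_assoc y, ← h]; group
  have h2 : y * x * y * x⁻¹ * y⁻¹ = x := by rw [← h]; group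
  constructor
  · calc y * x ^ 2 * y⁻¹ = (y * x * y⁻¹) ^ 2 := by rw [pow_two, pow_two]; group
      _ = _ := by rw [h1, pow_two, pow_two, pow_two]; group
  · calc y * (x * y ^ 2 * x⁻¹) * y⁻¹ = (y * x * y * x⁻¹ * y⁻¹) ^ 2 := by rw [pow_two, pow_two]; group
      _ = _ := by rw [h2]

/-- The braid `σ₀ ⋯ σ_{k-1}`. -/
def run (n k : ℕ) : BraidGroup n := seg (sgen n) 0 k

/-- The pure braid in which the first strand encircles the strand `k + 1`. -/
def loop (n k : ℕ) : BraidGroup n := run n k * sgen n k ^ 2 * (run n k)⁻¹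

/-- The subgroup generated by all Artin generators but the first one. -/
def tailSubgroup (n : ℕ) : Subgroup (BraidGroup n) :=
  Subgroup.closure {x | ∃ j, 1 ≤ j ∧ j < n - 1 ∧ x = sgen n j}

theorem sgen_mem_tailSubgroup {j : ℕ} (h : 1 ≤ j) (hj : j < n - 1) : sgen n j ∈ tailSubgroup n :=
  Subgroup.subset_closure ⟨j, h, hj, rfl⟩

theorem run_zero : run n 0 = 1 := rfl

theorem run_succ (k : ℕ) : run n (k + 1) = run n k * sgen n k := by
  simp [run, seg_succ_right]

theorem sgen_mul_run {k j : ℕ} (h : k + 1 ≤ j) : sgen n j * run n k = run n k * sgen n j := by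
  induction k with
  | zero => simp [run_zero]
  | succ k ih =>
    rw [run_succ, ← mul_assoc, ih (by omega), mul_assoc, ← sgen_comm (by omega), mul_assoc]

theorem run_mul_sgen {k j : ℕ} (h : j + 2 ≤ k) (hk : k ≤ n - 1) :
    run n k * sgen n j = sgen n (j + 1) * run n k := by
  induction k, h using Nat.le_induction with
  | base =>
    rw [run_succ, run_succ, mul_assoc, mul_assoc, ← mul_assoc (sgen n j), sgen_braid (by omega),
      mul_assoc, ← mul_assoc, ← sgen_mul_run le_rfl, mul_assoc, mul_assoc (run n j)]
  | succ k h ih =>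
    rw [run_succ, mul_assoc, ← sgen_comm h, ← mul_assoc, ih (by omega), mul_assoc]

theorem sgen_conj_loop_of_lt {k j : ℕ} (h : k + 2 ≤ j) :
    sgen n j * loop n k * (sgen n j)⁻¹ = loop n k := by
  have h1 := sgen_mul_run (n := n) (k := k) (j := j) (by omega)
  have h2 := sgen_comm (n := n) h
  rw [mul_inv_eq_iff_eq_mul, loop]
  change Commute (sgen n j) _
  exact ((show Commute (sgen n j) (run n k) from h1).mul_right
    ((show Commute (sgen n j) (sgen n k) from h2.symm).pow_right 2)).mul_right
    (show Commute (sgen n j) (run n k) from h1).inv_right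

theorem sgen_conj_loop_of_gt {k j : ℕ} (h : j + 2 ≤ k) (hk : k < n - 1) :
    sgen n (j + 1) * loop n k * (sgen n (j + 1))⁻¹ = loop n k := by
  have h1 := run_mul_sgen (n := n) h (by omega)
  have h2 : Commute (sgen n j) (sgen n k ^ 2) :=
    (show Commute (sgen n j) (sgen n k) from sgen_comm h).pow_right 2
  have h3 : sgen n (j + 1) = run n k * sgen n j * (run n k)⁻¹ := by rw [h1]; group
  rw [h3, loop]
  calc _ = run n k * (sgen n j * sgen n k ^ 2) * (sgen n j)⁻¹ * (run n k)⁻¹ := by group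
    _ = _ := by rw [h2.eq]; group

theorem sgen_conj_loop_self {k : ℕ} (hk : k + 1 < n - 1) :
    sgen n (k + 1) * loop n k * (sgen n (k + 1))⁻¹ =
      (loop n k)⁻¹ * loop n (k + 1) * loop n k := by
  have h := (conj_sq_eq_of_braid (sgen_braid hk)).1
  have h1 := sgen_mul_run (n := n) (k := k) (j := k + 1) le_rfl
  rw [loop, loop, run_succ]
  calc _ = (sgen n (k + 1) * run n k) * sgen n k ^ 2 * (sgen n (k + 1) * run n k)⁻¹ := by group
    _ = run n k * (sgen n (k + 1) * sgen n k ^ 2 * (sgen n (k + 1))⁻¹) * (run n k)⁻¹ := by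
      rw [h1]; group
    _ = _ := by rw [h]; group

theorem sgen_conj_loop_succ {k : ℕ} (hk : k + 1 < n - 1) :
    sgen n (k + 1) * loop n (k + 1) * (sgen n (k + 1))⁻¹ = loop n k := by
  have h := (conj_sq_eq_of_braid (sgen_braid hk)).2
  have h1 := sgen_mul_run (n := n) (k := k) (j := k + 1) le_rfl
  rw [loop, loop, run_succ]
  calc _ = (sgen n (k + 1) * run n k) * (sgen n k * sgen n (k + 1) ^ 2 * (sgen n k)⁻¹) *
        (sgen n (k + 1) * run n k)⁻¹ := by group
    _ = run n k * (sgen n (k + 1) * (sgen n k * sgen n (k + 1) ^ 2 * (sgen n k)⁻¹) *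
        (sgen n (k + 1))⁻¹) * (run n k)⁻¹ := by
      rw [h1]; group
    _ = _ := by rw [h]

/-- The homomorphism onto the subgroup generated by the braids `loop`. -/
def loopHom (n : ℕ) : FreeGroup (Fin (n - 1)) →* BraidGroup n :=
  FreeGroup.lift fun k => loop n k

theorem loop_mem_range {k : ℕ} (hk : k < n - 1) : loop n k ∈ (loopHom n).range :=
  ⟨of ⟨k, hk⟩, by simp [loopHom]⟩

/-- The later generators normalize the group of loops. Both signs of conjugation are needed, since
invariance under a generator alone would not give invariance under its inverse. -/
theorem conj_loop_mem_range {j k : ℕ} (hj : 1 ≤ j) (hj' : j < n - 1) (hk : k < n - 1) :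
    sgen n j * loop n k * (sgen n j)⁻¹ ∈ (loopHom n).range ∧
      (sgen n j)⁻¹ * loop n k * sgen n j ∈ (loopHom n).range := by
  have inv : ∀ {x y z : BraidGroup n}, x * y * x⁻¹ = z → x⁻¹ * z * x = y := by
    rintro x y z rfl; group
  obtain ⟨l, rfl⟩ : ∃ l, j = l + 1 := ⟨j - 1, by omega⟩
  rcases lt_trichotomy k l with h | rfl | h
  · have h1 := sgen_conj_loop_of_lt (n := n) (k := k) (j := l + 1) (by omega)
    rw [h1, inv h1]
    exact ⟨loop_mem_range hk, loop_mem_range hk⟩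
  · have h1 := sgen_conj_loop_self hj'
    have h2 := sgen_conj_loop_succ hj'
    rw [h1, inv h2]
    exact ⟨mul_mem (mul_mem (inv_mem (loop_mem_range hk)) (loop_mem_range hj'))
      (loop_mem_range hk), loop_mem_range hj'⟩
  rcases Nat.lt_or_ge (l + 1) k with h' | h'
  · have h1 := sgen_conj_loop_of_gt (n := n) (k := k) (j := l) h' hk
    rw [h1, inv h1]
    exact ⟨loop_mem_range hk, loop_mem_range hk⟩
  · obtain rfl : k = l + 1 := by omega
    have hl : l < n - 1 := by omega
    have h1 := sgen_conj_loop_self hj'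
    have h2 := sgen_conj_loop_succ hj'
    have h3 : (sgen n (l + 1))⁻¹ * loop n (l + 1) * sgen n (l + 1) =
        loop n (l + 1) * loop n l * (loop n (l + 1))⁻¹ := by
      have h4 := inv h2
      have h5 : loop n (l + 1) = loop n l * (sgen n (l + 1) * loop n l * (sgen n (l + 1))⁻¹) *
          (loop n l)⁻¹ := by rw [h1]; group
      calc _ = ((sgen n (l + 1))⁻¹ * loop n l * sgen n (l + 1)) * loop n l *
            ((sgen n (l + 1))⁻¹ * loop n l * sgen n (l + 1))⁻¹ := by
            conv_lhs => rw [h5]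
            group
        _ = _ := by rw [h4]
    rw [h2, h3]
    exact ⟨loop_mem_range hl, mul_mem (mul_mem (loop_mem_range hk) (loop_mem_range hl))
      (inv_mem (loop_mem_range hk))⟩

theorem conj_mem_range_loopHom {h : BraidGroup n} (hh : h ∈ tailSubgroup n) :
    ∀ u ∈ (loopHom n).range, h * u * h⁻¹ ∈ (loopHom n).range := by
  have key : ∀ x : BraidGroup n, (∀ k < n - 1, x * loop n k * x⁻¹ ∈ (loopHom n).range) →
      ∀ u ∈ (loopHom n).range, x * u * x⁻¹ ∈ (loopHom n).range := by
    rintro x hx _ ⟨v, rfl⟩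
    induction v using FreeGroup.induction_on with
    | C1 => simp
    | of k =>
      have := hx k k.2
      simpa [loopHom] using this
    | inv_of k ih =>
      have := inv_mem ih
      simpa [mul_assoc] using this
    | mul v w hv hw =>
      have := mul_mem hv hw
      simpa [mul_assoc] using this
  induction hh using Subgroup.closure_induction_left with
  | one => simp
  | mul_left x hx y hy ih =>
    obtain ⟨j, h1, h2, rfl⟩ := hx
    intro u hu
    have := key _ (fun k hk => (conj_loop_mem_range h1 h2 hk).1) _ (ih u hu)
    simpa [mul_assoc] using this
  | inv_mul_cancel x hx y hy ih =>
    obtain ⟨j, h1, h2, rfl⟩ := hx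
    intro u hu
    have := key (sgen n j)⁻¹ (fun k hk => by
      simpa using (conj_loop_mem_range h1 h2 hk).2) _ (ih u hu)
    simpa [mul_assoc] using this

/-- A normal form: `run n k` records the coset determined by the first strand's endpoint, and the
remaining factor is a loop of that strand times a braid of the others. The set of such products
contains 1 and is stable under right multiplication by generators and their inverses. -/
theorem exists_eq_loopHom_mul (β : BraidGroup n) :
    ∃ u ∈ (loopHom n).range, ∃ h ∈ tailSubgroup n, ∃ k ≤ n - 1, β = u * h * run n k := by
  have hβ : β ∈ Subgroup.closure {x | ∃ j < n - 1, x = sgen n j} :=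
    mem_of_sgen_mem (Subgroup.closure {x | ∃ j < n - 1, x = sgen n j})
      (fun j hj => Subgroup.subset_closure ⟨j, hj, rfl⟩) β
  have loopstep : ∀ {u h x y : BraidGroup n}, u ∈ (loopHom n).range → h ∈ tailSubgroup n →
      x ∈ (loopHom n).range → ∃ u' ∈ (loopHom n).range, u * h * (x * y) = u' * h * y := by
    intro u h x y hu hh hx
    exact ⟨u * (h * x * h⁻¹), mul_mem hu (conj_mem_range_loopHom hh x hx), by group⟩
  induction hβ using Subgroup.closure_induction_right with
  | one => exact ⟨1, one_mem _, 1, one_mem _, 0, by omega, by simp [run_zero]⟩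
  | mul_right x hx y hy ih =>
    obtain ⟨u, hu, h, hh, k, hk, rfl⟩ := ih
    obtain ⟨j, hj, rfl⟩ := hy
    rcases lt_trichotomy k j with hlt | rfl | hgt
    · refine ⟨u, hu, h * sgen n j, mul_mem hh (sgen_mem_tailSubgroup (by omega) hj), k, hk, ?_⟩
      rw [mul_assoc, ← sgen_mul_run (by omega)]; group
    · exact ⟨u, hu, h, hh, k + 1, by omega, by rw [run_succ]; group⟩
    rcases Nat.lt_or_ge (j + 1) k with h' | h'
    · refine ⟨u, hu, h * sgen n (j + 1), mul_mem hh (sgen_mem_tailSubgroup (by omega) (by omega)),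
        k, hk, ?_⟩
      rw [mul_assoc, run_mul_sgen h' hk]; group
    · obtain rfl : k = j + 1 := by omega
      obtain ⟨u', hu', e⟩ := loopstep (y := run n j) hu hh (loop_mem_range hj)
      refine ⟨u', hu', h, hh, j, by omega, ?_⟩
      rw [← e, loop, run_succ, pow_two]; group
  | mul_inv_cancel x hx y hy ih =>
    obtain ⟨u, hu, h, hh, k, hk, rfl⟩ := ih
    obtain ⟨j, hj, rfl⟩ := hy
    rcases lt_trichotomy k j with hlt | rfl | hgt
    · refine ⟨u, hu, h * (sgen n j)⁻¹,
        mul_mem hh (inv_mem (sgen_mem_tailSubgroup (by omega) hj)), k, hk, ?_⟩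
      have := sgen_mul_run (n := n) (k := k) (j := j) (by omega)
      rw [mul_inv_eq_iff_eq_mul]
      calc _ = u * h * (sgen n j)⁻¹ * (sgen n j * run n k) := by group
        _ = _ := by rw [this]; group
    · obtain ⟨u', hu', e⟩ := loopstep (y := run n (k + 1)) hu hh (inv_mem (loop_mem_range hj))
      refine ⟨u', hu', h, hh, k + 1, by omega, ?_⟩
      rw [← e, loop, run_succ, pow_two]; group
    rcases Nat.lt_or_ge (j + 1) k with h' | h'
    · refine ⟨u, hu, h * (sgen n (j + 1))⁻¹,
        mul_mem hh (inv_mem (sgen_mem_tailSubgroup (by omega) (by omega))), k, hk, ?_⟩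
      have := run_mul_sgen (n := n) h' hk
      rw [mul_inv_eq_iff_eq_mul]
      calc _ = u * h * (sgen n (j + 1))⁻¹ * (sgen n (j + 1) * run n k) := by group
        _ = _ := by rw [← this]; group
    · obtain rfl : k = j + 1 := by omega
      exact ⟨u, hu, h, hh, j, by omega, by rw [run_succ]; group⟩

/-! #### The action of the loops -/

/-- The automorphism by which `run n k` acts. -/
theorem seg_hurwitz_of (k j : ℕ) : seg hurwitz 0 k (of j) =
    if j < k then of 0 * of (j + 1) * (of 0)⁻¹ else if j = k then of 0 else of j := by
  induction k generalizing j with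
  | zero => simpa [seg_zero] using fun h => by rw [h]
  | succ k ih =>
    rw [seg_succ_right, MulAut.mul_apply, zero_add]
    rcases lt_trichotomy j k with h | rfl | h
    · rw [hurwitz_of_ne (by omega) (by omega), ih, if_pos h, if_pos (by omega)]
    · simp [ih]
    rcases Nat.lt_or_ge (k + 1) j with h' | h'
    · rw [hurwitz_of_ne (by omega) (by omega), ih, if_neg (by omega), if_neg (by omega),
        if_neg (by omega), if_neg (by omega)]
    · obtain rfl : j = k + 1 := by omega
      simp [ih]

theorem act_run {k : ℕ} (hk : k ≤ n - 1) : act (run n k) = seg hurwitz 0 k := by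
  rw [run, map_seg]
  exact seg_congr fun j _ h => act_sgen (by omega)

/-- The endomorphism which kills the first generator. -/
def killZero : FreeGroup ℕ →* FreeGroup ℕ := FreeGroup.lift fun j => if j = 0 then 1 else of j

/-- The exponent sum of the first generator. -/
def zeroExponent : FreeGroup ℕ →* Multiplicative ℤ :=
  FreeGroup.lift fun j => if j = 0 then Multiplicative.ofAdd 1 else 1

theorem hom_act_loop {G : Type*} [Group G] {χ : FreeGroup ℕ →* G} {k : ℕ} (hk : k < n - 1)
    (h : ∀ g, χ (seg hurwitz 0 k (hurwitz k (hurwitz k g))) = χ (seg hurwitz 0 k g))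
    (g : FreeGroup ℕ) : χ (act (loop n k) g) = χ g := by
  rw [loop, _root_.map_mul, _root_.map_mul, _root_.map_inv, _root_.map_pow, act_run hk.le,
    act_sgen hk, MulAut.mul_apply, MulAut.mul_apply, pow_two, MulAut.mul_apply, h,
    MulAut.apply_inv_self]

/-- Only x_k and x_{k+1} are changed by the square of the generator, and the two hypotheses are the
resulting identities after applying the run. -/
theorem hom_seg_hurwitz {G : Type*} [Group G] {χ : FreeGroup ℕ →* G} {k : ℕ}
    (h1 : χ (of 0 * of (k + 1) * of 0 * (of (k + 1))⁻¹ * (of 0)⁻¹) = χ (of 0))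
    (h2 : χ (of 0 * of (k + 1) * (of 0)⁻¹) = χ (of (k + 1))) (g : FreeGroup ℕ) :
    χ (seg hurwitz 0 k (hurwitz k (hurwitz k g))) = χ (seg hurwitz 0 k g) := by
  have : (χ.comp (seg hurwitz 0 k : MulAut (FreeGroup ℕ)).toMonoidHom).comp
      ((hurwitz k).toMonoidHom.comp (hurwitz k).toMonoidHom) =
      χ.comp (seg hurwitz 0 k : MulAut (FreeGroup ℕ)).toMonoidHom := by
    refine FreeGroup.ext_hom _ _ fun j => ?_
    simp only [MonoidHom.comp_apply, MulEquiv.coe_toMonoidHom]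
    rcases eq_or_ne j k with rfl | h
    · simpa [seg_hurwitz_of, mul_assoc] using h1
    rcases eq_or_ne j (k + 1) with rfl | h'
    · simpa [seg_hurwitz_of, mul_assoc] using h2
    · rw [hurwitz_of_ne h h', hurwitz_of_ne h h']
  exact DFunLike.congr_fun this g

theorem killZero_act_loop {k : ℕ} (hk : k < n - 1) (g : FreeGroup ℕ) :
    killZero (act (loop n k) g) = killZero g :=
  hom_act_loop hk (hom_seg_hurwitz (by simp [killZero]) (by simp [killZero])) g

theorem zeroExponent_act_loop {k : ℕ} (hk : k < n - 1) (g : FreeGroup ℕ) :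
    zeroExponent (act (loop n k) g) = zeroExponent g :=
  hom_act_loop hk (hom_seg_hurwitz (by simp [zeroExponent]) (by simp [zeroExponent])) g

theorem act_loop_zero {k : ℕ} (hk : k < n - 1) :
    act (loop n k) (of 0) = of 0 * of (k + 1) * of 0 * (of 0 * of (k + 1))⁻¹ := by
  have h : (seg hurwitz 0 k)⁻¹ (of 0) = of k := by
    rw [MulAut.inv_apply, MulEquiv.symm_apply_eq]
    simp [seg_hurwitz_of]
  rw [loop, _root_.map_mul, _root_.map_mul, _root_.map_inv, _root_.map_pow, act_run hk.le,
    act_sgen hk, MulAut.mul_apply, MulAut.mul_apply, pow_two, MulAut.mul_apply, h]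
  simp [seg_hurwitz_of, mul_assoc]

theorem zeroExponent_act_of_mem_range {u : BraidGroup n} (hu : u ∈ (loopHom n).range)
    (g : FreeGroup ℕ) : zeroExponent (act u g) = zeroExponent g := by
  obtain ⟨v, rfl⟩ := hu
  induction v using FreeGroup.induction_on generalizing g with
  | C1 => simp
  | of k => simpa [loopHom] using zeroExponent_act_loop k.2 g
  | inv_of k ih =>
    have := ih ((act (loopHom n (of k)))⁻¹ g)
    rw [MulAut.apply_inv_self] at this
    rw [_root_.map_inv, _root_.map_inv, this]
  | mul v w hv hw => rw [_root_.map_mul, _root_.map_mul, MulAut.mul_apply, hv, hw]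

theorem act_zero_of_mem_tailSubgroup {h : BraidGroup n} (hh : h ∈ tailSubgroup n) :
    act h (of 0) = of 0 := by
  induction hh using Subgroup.closure_induction with
  | mem x hx =>
    obtain ⟨j, h1, h2, rfl⟩ := hx
    rw [act_sgen h2, hurwitz_of_ne (by omega) (by omega)]
  | one => simp
  | mul x y _ _ hx hy => rw [_root_.map_mul, MulAut.mul_apply, hy, hx]
  | inv x _ hx => rw [_root_.map_inv, MulAut.inv_apply, MulEquiv.symm_apply_eq, hx]

theorem zeroExponent_act_of_mem_tailSubgroup {h : BraidGroup n} (hh : h ∈ tailSubgroup n)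
    (g : FreeGroup ℕ) : zeroExponent (act h g) = zeroExponent g := by
  induction hh using Subgroup.closure_induction generalizing g with
  | mem x hx =>
    obtain ⟨j, h1, h2, rfl⟩ := hx
    rw [act_sgen h2]
    have : zeroExponent.comp (hurwitz j).toMonoidHom = zeroExponent := by
      refine FreeGroup.ext_hom _ _ fun i => ?_
      simp only [MonoidHom.comp_apply, MulEquiv.coe_toMonoidHom]
      rcases eq_or_ne i j with rfl | h
      · simp [zeroExponent, show i ≠ 0 by omega]
      rcases eq_or_ne i (j + 1) with rfl | h'
      · simp [zeroExponent, show j ≠ 0 by omega]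
      · rw [hurwitz_of_ne h h']
    exact DFunLike.congr_fun this g
  | one => simp
  | mul x y _ _ hx hy => rw [_root_.map_mul, MulAut.mul_apply, hx, hy]
  | inv x _ hx =>
    have := hx ((act x)⁻¹ g)
    rw [MulAut.apply_inv_self] at this
    rw [_root_.map_inv, this]

/-- Let the other generators translate two copies of the free group, and let x_0 only swap the two
base points. The first coordinate sees `killZero g`; were it nontrivial, `g` would carry the base
points to points fixed by x_0, contradicting that `g` commutes with x_0. -/
theorem killZero_eq_one_of_conj {g : FreeGroup ℕ} (h : g * of 0 * g⁻¹ = of 0) : killZero g = 1 := by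
  classical
  let Φ : FreeGroup ℕ →* Equiv.Perm (FreeGroup ℕ × Bool) := FreeGroup.lift fun j =>
    if j = 0 then Equiv.swap (1, false) (1, true) else (Equiv.mulLeft (of j)).prodCongr (Equiv.refl _)
  have hΦ0 : Φ (of 0) = Equiv.swap (1, false) (1, true) := by simp [Φ]
  have hfst : ∀ p, (Φ g p).1 = killZero g * p.1 := by
    clear h
    induction g using FreeGroup.induction_on with
    | C1 => simp
    | of j =>
      intro p
      by_cases hj : j = 0
      · subst hj
        rw [hΦ0]
        simp only [Equiv.swap_apply_def]
        split_ifs with h1 h2 <;> simp_all [killZero]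
      · simp [Φ, killZero, hj]
    | inv_of j ih =>
      intro p
      have := ih ((Φ (of j))⁻¹ p)
      rw [← Equiv.Perm.mul_apply, mul_inv_cancel, Equiv.Perm.one_apply] at this
      rw [_root_.map_inv, _root_.map_inv, this, inv_mul_cancel_left]
    | mul v w hv hw =>
      intro p
      rw [_root_.map_mul, Equiv.Perm.mul_apply, hv, hw, _root_.map_mul, mul_assoc]
  have h1 : Φ (of 0) (Φ g (1, false)) = Φ g (1, true) := by
    have := congrArg (fun φ => φ (Φ g (1, false))) (congrArg Φ h)
    simp only [_root_.map_mul, _root_.map_inv, Equiv.Perm.mul_apply] at this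
    rw [← Equiv.Perm.mul_apply (Φ g)⁻¹, inv_mul_cancel, Equiv.Perm.one_apply] at this
    rw [← this, hΦ0, Equiv.swap_apply_left]
  by_contra hne
  have h2 : (Φ g (1, false)).1 ≠ 1 := by rw [hfst]; simpa using hne
  rw [hΦ0, Equiv.swap_apply_of_ne_of_ne (fun e => h2 (by rw [e])) (fun e => h2 (by rw [e]))] at h1
  simpa using (Φ g).injective h1

/-- Loops act trivially modulo x_0, so the conjugator that carries x_0 to its image is
multiplicative modulo x_0. This recovers `v` from the action on x_0. -/
theorem exists_act_loopHom_zero (v : FreeGroup (Fin (n - 1))) :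
    (∀ g, killZero (act (loopHom n v) g) = killZero g) ∧
    ∃ g, act (loopHom n v) (of 0) = g * of 0 * g⁻¹ ∧
      killZero g⁻¹ = FreeGroup.lift (fun k : Fin (n - 1) => (of ((k : ℕ) + 1))⁻¹) v := by
  induction v using FreeGroup.induction_on with
  | C1 => exact ⟨by simp, 1, by simp, by simp⟩
  | of k =>
    refine ⟨fun g => by simpa [loopHom] using killZero_act_loop k.2 g,
      of 0 * of ((k : ℕ) + 1), ?_, by simp [killZero]⟩
    rw [loopHom, lift_apply_of, act_loop_zero k.2]
  | inv_of k ih =>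
    obtain ⟨h1, g, h2, h3⟩ := ih
    have h4 : ∀ g, killZero (act (loopHom n (of k)⁻¹) g) = killZero g := by
      intro g
      have := h1 ((act (loopHom n (of k)))⁻¹ g)
      rw [MulAut.apply_inv_self] at this
      rw [_root_.map_inv, _root_.map_inv, this]
    refine ⟨h4, (act (loopHom n (of k)⁻¹) g)⁻¹, ?_, ?_⟩
    · rw [_root_.map_inv, _root_.map_inv, inv_inv]
      apply (act (loopHom n (of k))).injective
      rw [_root_.map_mul, _root_.map_mul, _root_.map_inv, MulAut.apply_inv_self,
        MulAut.apply_inv_self, h2]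
      group
    · rw [inv_inv, h4, _root_.map_inv, ← h3, _root_.map_inv, inv_inv]
  | mul v w hv hw =>
    obtain ⟨h1, g, h2, h3⟩ := hv
    obtain ⟨h4, g', h5, h6⟩ := hw
    refine ⟨fun x => by rw [_root_.map_mul, _root_.map_mul, MulAut.mul_apply, h1, h4],
      act (loopHom n v) g' * g, ?_, ?_⟩
    · rw [_root_.map_mul, _root_.map_mul, MulAut.mul_apply, h5]
      simp only [_root_.map_mul, _root_.map_inv, h2]
      group
    · rw [mul_inv_rev, _root_.map_mul, _root_.map_mul, h3, ← _root_.map_inv, h1, h6]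

/-- A braid which fixes the first generator of the free group is a product of the other Artin
generators and their inverses. -/
theorem mem_tailSubgroup_of_act_zero {β : BraidGroup n} (h : act β (of 0) = of 0) :
    β ∈ tailSubgroup n := by
  obtain ⟨u, hu, t, ht, k, hk, rfl⟩ := exists_eq_loopHom_mul β
  -- For positive `k` the run sends x_0 to a conjugate of x_1, whose exponent sum in x_0 is 0
  -- instead of 1.
  have hk0 : k = 0 := by
    by_contra hk0
    have := congrArg zeroExponent h
    rw [_root_.map_mul, _root_.map_mul, MulAut.mul_apply, MulAut.mul_apply,
      zeroExponent_act_of_mem_range hu, zeroExponent_act_of_mem_tailSubgroup ht, act_run hk,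
      seg_hurwitz_of, if_pos (by omega)] at this
    simp [zeroExponent] at this
    exact absurd this (by decide)
  subst hk0
  rw [run_zero, mul_one] at h ⊢
  rw [_root_.map_mul, MulAut.mul_apply, act_zero_of_mem_tailSubgroup ht] at h
  obtain ⟨v, rfl⟩ := hu
  obtain ⟨-, g, h1, h2⟩ := exists_act_loopHom_zero v
  have h3 := killZero_eq_one_of_conj (h1.symm.trans h)
  rw [_root_.map_inv, h3, inv_one] at h2
  -- The map sending the k-th letter to x_{k+1}⁻¹ is injective, with left inverse `ψ`.
  have h4 : v = 1 := by
    let ψ : FreeGroup ℕ →* FreeGroup (Fin (n - 1)) := FreeGroup.lift fun j =>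
      if hj : j - 1 < n - 1 then (of ⟨j - 1, hj⟩)⁻¹ else 1
    have h5 : ψ.comp (FreeGroup.lift fun k : Fin (n - 1) => (of ((k : ℕ) + 1))⁻¹) =
        MonoidHom.id _ := by
      refine FreeGroup.ext_hom _ _ fun k => ?_
      simp [ψ]
    have h6 := DFunLike.congr_fun h5 v
    rw [MonoidHom.comp_apply, ← h2, _root_.map_one] at h6
    exact h6.symm
  rw [h4, _root_.map_one, one_mul]
  exact ht

end BraidGroup

/-! ### Comparison of braids -/

namespace BraidGroup

open FreeGroup HurwitzOrder

variable {n : ℕ}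

/-- `β` is represented by a `σ_i`-positive word. -/
def SigmaPos (i : Fin (n - 1)) (β : BraidGroup n) : Prop :=
  ∃ L, IsSigmaPositiveWord i L ∧ ofWord L = β

theorem ofWord_nil : (ofWord [] : BraidGroup n) = 1 := rfl

theorem ofWord_cons (x : Fin (n - 1) × Bool) (L : List (Fin (n - 1) × Bool)) :
    ofWord (x :: L) = (if x.2 then gen x.1 else (gen x.1)⁻¹) * ofWord L := by
  simp [ofWord]

theorem ofWord_append (L L' : List (Fin (n - 1) × Bool)) :
    ofWord (L ++ L') = ofWord L * ofWord L' := by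
  simp [ofWord]

theorem SigmaPos.dehornoyPos {i : Fin (n - 1)} {β : BraidGroup n} (h : SigmaPos i β) :
    DehornoyPos β := ⟨i, h⟩

theorem DehornoyPos.mul {α β : BraidGroup n} (hα : DehornoyPos α) (hβ : DehornoyPos β) :
    DehornoyPos (α * β) := by
  obtain ⟨i, L, ⟨h1, h2, h3⟩, rfl⟩ := hα
  obtain ⟨j, L', ⟨h1', h2', h3'⟩, rfl⟩ := hβ
  refine ⟨min i j, L ++ L', ⟨?_, ?_, ?_⟩, ofWord_append _ _⟩
  · rcases min_choice i j with h | h <;> simp [h, h1, h1']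
  · rw [List.mem_append, not_or]
    refine ⟨fun h => ?_, fun h => ?_⟩
    · have := h3 _ h
      rw [le_antisymm (min_le_left i j) this] at h
      exact h2 h
    · have := h3' _ h
      rw [le_antisymm (min_le_right i j) this] at h
      exact h2' h
  · intro x hx
    rcases List.mem_append.1 hx with h | h
    · exact (min_le_left i j).trans (h3 x h)
    · exact (min_le_right i j).trans (h3' x h)

theorem SigmaPos.mul {i : Fin (n - 1)} {α β : BraidGroup n} (hα : SigmaPos i α)
    (hβ : SigmaPos i β) : SigmaPos i (α * β) := by
  obtain ⟨L, ⟨h1, h2, h3⟩, rfl⟩ := hα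
  obtain ⟨L', ⟨h1', h2', h3'⟩, rfl⟩ := hβ
  refine ⟨L ++ L', ⟨by simp [h1], by simp [h2, h2'], fun x hx => ?_⟩, ofWord_append _ _⟩
  rcases List.mem_append.1 hx with h | h
  · exact h3 x h
  · exact h3' x h

theorem sigmaPos_gen (i : Fin (n - 1)) : SigmaPos i (gen i) :=
  ⟨[(i, true)], ⟨by simp, by simp, by simp⟩, by simp [ofWord]⟩

/-- The product of a `σ_i`-positive braid with a braid which is represented by a word in the later
generators. -/
theorem SigmaPos.mul_word {i : Fin (n - 1)} {β : BraidGroup n} (hβ : SigmaPos i β)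
    {L : List (Fin (n - 1) × Bool)} (hL : ∀ x ∈ L, i < x.1) :
    SigmaPos i (β * ofWord L) ∧ SigmaPos i (ofWord L * β) := by
  obtain ⟨L', ⟨h1, h2, h3⟩, rfl⟩ := hβ
  have hL' : (i, false) ∉ L := fun h => lt_irrefl _ (hL _ h)
  refine ⟨⟨L' ++ L, ⟨by simp [h1], by simp [h2, hL'], fun x hx => ?_⟩, ofWord_append _ _⟩,
    ⟨L ++ L', ⟨by simp [h1], by simp [h2, hL'], fun x hx => ?_⟩, ofWord_append _ _⟩⟩ <;>
  rcases List.mem_append.1 hx with h | h <;>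
  first
  | exact h3 x h
  | exact (hL x h).le

theorem exists_ofWord_eq_of_mem_tailSubgroup {h : BraidGroup n} (hh : h ∈ tailSubgroup n) :
    ∃ L : List (Fin (n - 1) × Bool), (∀ x ∈ L, 0 < (x.1 : ℕ)) ∧ ofWord L = h := by
  induction hh using Subgroup.closure_induction_left with
  | one => exact ⟨[], by simp, rfl⟩
  | mul_left x hx y hy ih =>
    obtain ⟨j, h1, h2, rfl⟩ := hx
    obtain ⟨L, hL, rfl⟩ := ih
    refine ⟨(⟨j, h2⟩, true) :: L, ?_, by simp [ofWord_cons, sgen, h2]⟩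
    simpa using ⟨by omega, fun a => ⟨fun h => hL _ h, fun h => hL _ h⟩⟩
  | inv_mul_cancel x hx y hy ih =>
    obtain ⟨j, h1, h2, rfl⟩ := hx
    obtain ⟨L, hL, rfl⟩ := ih
    refine ⟨(⟨j, h2⟩, false) :: L, ?_, by simp [ofWord_cons, sgen, h2]⟩
    simpa using ⟨by omega, fun a => ⟨fun h => hL _ h, fun h => hL _ h⟩⟩

theorem SigmaPos.mul_tail {hn : 0 < n - 1} {β h : BraidGroup n} (hβ : SigmaPos ⟨0, hn⟩ β)
    (hh : h ∈ tailSubgroup n) : SigmaPos ⟨0, hn⟩ (β * h) := by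
  obtain ⟨L, hL, rfl⟩ := exists_ofWord_eq_of_mem_tailSubgroup hh
  exact (hβ.mul_word fun x hx => hL x hx).1

theorem SigmaPos.tail_mul {hn : 0 < n - 1} {β h : BraidGroup n} (hβ : SigmaPos ⟨0, hn⟩ β)
    (hh : h ∈ tailSubgroup n) : SigmaPos ⟨0, hn⟩ (h * β) := by
  obtain ⟨L, hL, rfl⟩ := exists_ofWord_eq_of_mem_tailSubgroup hh
  exact (hβ.mul_word fun x hx => hL x hx).2

/-- The braid `σ_{k-1} ⋯ σ₀`. -/
def revRun (n : ℕ) : ℕ → BraidGroup n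
  | 0 => 1
  | k + 1 => sgen n k * revRun n k

theorem sigmaPos_sgen_zero (hn : 0 < n - 1) : SigmaPos ⟨0, hn⟩ (sgen n 0) := by
  have := sigmaPos_gen (n := n) ⟨0, hn⟩
  rwa [← sgen_eq_gen] at this

theorem sigmaPos_run {hn : 0 < n - 1} {k : ℕ} (hk : k + 1 ≤ n - 1) :
    SigmaPos ⟨0, hn⟩ (run n (k + 1)) := by
  induction k with
  | zero => simpa [run_succ, run_zero] using sigmaPos_sgen_zero hn
  | succ k ih =>
    rw [run_succ]
    exact (ih (by omega)).mul_tail (sgen_mem_tailSubgroup (by omega) (by omega))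

theorem sigmaPos_revRun {hn : 0 < n - 1} {k : ℕ} (hk : k + 1 ≤ n - 1) :
    SigmaPos ⟨0, hn⟩ (revRun n (k + 1)) := by
  induction k with
  | zero => simpa [revRun] using sigmaPos_sgen_zero hn
  | succ k ih =>
    rw [revRun]
    exact (ih (by omega)).tail_mul (sgen_mem_tailSubgroup (by omega) (by omega))

theorem hurwitz_seg_of {i m : ℕ} (h : i + 1 < m) : hurwitz i (seg of 0 m) = seg of 0 m := by
  obtain ⟨l, rfl⟩ : ∃ l, m = i + (2 + l) := ⟨m - (i + 2), by omega⟩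
  have h1 : hurwitz i (seg of 0 i) = seg of 0 i := by
    rw [map_seg]
    exact seg_congr fun j _ hj => hurwitz_of_ne (by omega) (by omega)
  have h2 : hurwitz i (seg of (0 + i + 2) l) = seg of (0 + i + 2) l := by
    rw [map_seg]
    exact seg_congr fun j hj _ => hurwitz_of_ne (by omega) (by omega)
  have h3 : (seg of (0 + i) 2 : FreeGroup ℕ) = of i * of (i + 1) := by
    simp [seg_succ, seg_zero]
  simp only [zero_add] at h2 h3
  rw [seg_add, seg_add, zero_add, h3]
  simp [h1, h2]

/-- The product of all generators is the boundary loop of the punctured disk, which every braid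
fixes. -/
theorem act_seg_of (β : BraidGroup n) : act β (seg of 0 n) = seg of 0 n := by
  have : β ∈ (MulAction.stabilizer (MulAut (FreeGroup ℕ)) (seg of 0 n : FreeGroup ℕ)).comap act :=
    mem_of_sgen_mem _ (fun i hi => by
      rw [Subgroup.mem_comap, MulAction.mem_stabilizer_iff, act_sgen hi]
      exact hurwitz_seg_of (by omega)) β
  exact this

theorem act_run_seg_of {k : ℕ} (hk : k ≤ n - 1) : act (run n k) (seg of 0 (k + 1)) =
    seg of 0 (k + 1) := by
  suffices h : ∀ j ≤ k, act (run n j) (seg of 0 (k + 1)) = seg of 0 (k + 1) from h k le_rfl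
  intro j hj
  induction j with
  | zero => simp [run_zero]
  | succ j ih =>
    rw [run_succ, _root_.map_mul, MulAut.mul_apply, act_sgen (by omega),
      hurwitz_seg_of (by omega), ih (by omega)]

theorem act_revRun_seg_of {k : ℕ} (hk : k ≤ n - 1) : act (revRun n k) (seg of 0 (k + 1)) =
    seg of 0 (k + 1) := by
  suffices h : ∀ j ≤ k, act (revRun n j) (seg of 0 (k + 1)) = seg of 0 (k + 1) from h k le_rfl
  intro j hj
  induction j with
  | zero => simp [revRun]
  | succ j ih =>
    rw [revRun, _root_.map_mul, MulAut.mul_apply, ih (by omega), act_sgen (by omega),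
      hurwitz_seg_of (by omega)]

theorem act_revRun_zero {k : ℕ} (hk : k ≤ n - 1) : act (revRun n k) (of 0) =
    seg of 0 k * of k * (seg of 0 k)⁻¹ := by
  induction k with
  | zero => simp [revRun, seg_zero]
  | succ k ih =>
    have h1 : hurwitz k (seg of 0 k) = seg of 0 k := by
      rw [map_seg]
      exact seg_congr fun j _ hj => hurwitz_of_ne (by omega) (by omega)
    rw [revRun, _root_.map_mul, MulAut.mul_apply, ih (by omega), act_sgen (by omega)]
    simp [h1, seg_succ_right, mul_assoc]

/-- The action of the full turn of the first strand around the next `k` strands. -/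
theorem act_run_mul_revRun_zero {k : ℕ} (hk : k ≤ n - 1) :
    act (run n k * revRun n k) (of 0) =
      seg of 0 (k + 1) * of 0 * (seg of 0 (k + 1))⁻¹ := by
  have h1 : (seg of 0 k * of k * (seg of 0 k)⁻¹ : FreeGroup ℕ) =
      seg of 0 (k + 1) * of k * (seg of 0 (k + 1))⁻¹ := by
    rw [seg_succ_right, zero_add]; group
  rw [_root_.map_mul, MulAut.mul_apply, act_revRun_zero hk, h1, _root_.map_mul, _root_.map_mul,
    _root_.map_inv, act_run_seg_of hk, act_run hk, seg_hurwitz_of]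
  simp

theorem exists_act_of_eq_conj (β : BraidGroup n) (t : ℕ) :
    ∃ g k, act β (of t) = g * of k * g⁻¹ := by
  let S : Submonoid (MulAut (FreeGroup ℕ)) :=
    { carrier := {φ | ∀ t, ∃ g k, φ (of t) = g * of k * g⁻¹}
      mul_mem' := by
        intro φ ψ hφ hψ t
        obtain ⟨g, k, h⟩ := hψ t
        obtain ⟨g', k', h'⟩ := hφ k
        refine ⟨φ g * g', k', ?_⟩
        rw [MulAut.mul_apply, h]
        simp only [_root_.map_mul, _root_.map_inv, h']
        group
      one_mem' := fun t => ⟨1, t, by simp⟩ }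
  have h1 : ∀ i, hurwitz i ∈ S := by
    intro i t
    rcases eq_or_ne t i with rfl | h
    · exact ⟨of t, t + 1, by simp⟩
    rcases eq_or_ne t (i + 1) with rfl | h'
    · exact ⟨1, i, by simp⟩
    · exact ⟨1, t, by simp [hurwitz_of_ne h h']⟩
  have h2 : ∀ i, (hurwitz i)⁻¹ ∈ S := by
    intro i t
    rcases eq_or_ne t i with rfl | h
    · refine ⟨1, t + 1, ?_⟩
      rw [MulAut.inv_apply, MulEquiv.symm_apply_eq]
      simp
    rcases eq_or_ne t (i + 1) with rfl | h'
    · refine ⟨(of (i + 1))⁻¹, i, ?_⟩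
      rw [MulAut.inv_apply, MulEquiv.symm_apply_eq]
      simp [mul_assoc]
    · refine ⟨1, t, ?_⟩
      rw [MulAut.inv_apply, MulEquiv.symm_apply_eq]
      simp [hurwitz_of_ne h h']
  let K : Subgroup (BraidGroup n) :=
    { carrier := {β | act β ∈ S ∧ act β⁻¹ ∈ S}
      mul_mem' := by
        rintro α β ⟨ha, ha'⟩ ⟨hb, hb'⟩
        refine ⟨?_, ?_⟩
        · rw [_root_.map_mul]; exact S.mul_mem ha hb
        · rw [mul_inv_rev, _root_.map_mul]; exact S.mul_mem hb' ha'
      one_mem' := by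
        refine ⟨?_, ?_⟩
        · rw [_root_.map_one]; exact S.one_mem
        · rw [inv_one, _root_.map_one]; exact S.one_mem
      inv_mem' := by
        rintro α ⟨ha, ha'⟩
        exact ⟨ha', by rwa [inv_inv]⟩ }
  have : β ∈ K := mem_of_sgen_mem K (fun i hi => by
    refine ⟨?_, ?_⟩
    · rw [act_sgen hi]; exact h1 i
    · rw [_root_.map_inv, act_sgen hi]; exact h2 i) β
  exact this.1 t

theorem norm_conj_le (L : List (ℕ × Bool)) (k : ℕ) :
    norm (mk L * of k * (mk L)⁻¹) ≤ 2 * L.length + 1 := by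
  have h1 := norm_mul_le (mk L * of k) (mk L)⁻¹
  have h2 := norm_mul_le (mk L) (of k)
  have h3 : norm (mk L) ≤ L.length := norm_mk_le
  rw [norm_inv_eq] at h1
  rw [norm_of] at h2
  omega

theorem eq_conj_of_toWord {a : FreeGroup ℕ} {u : List (ℕ × Bool)} {k : ℕ}
    (h : a.toWord = u ++ (k, true) :: invRev u) : a = mk u * of k * (mk u)⁻¹ := by
  rw [← mk_toWord (x := a), h, of, inv_mk, mul_mk, mul_mk]
  simp

theorem norm_of_toWord {a : FreeGroup ℕ} {u : List (ℕ × Bool)} {k : ℕ}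
    (h : a.toWord = u ++ (k, true) :: invRev u) : norm a = 2 * u.length + 1 := by
  rw [FreeGroup.norm, h]
  simp; omega

theorem sum_lt_sum_of_pair {s : Finset ℕ} {f g : ℕ → ℕ} {i j : ℕ} (hi : i ∈ s) (hj : j ∈ s)
    (hij : i ≠ j) (h : f i + f j < g i + g j) (h' : ∀ t, t ≠ i → t ≠ j → f t = g t) :
    ∑ t ∈ s, f t < ∑ t ∈ s, g t := by
  have hj' : j ∈ s.erase i := Finset.mem_erase.2 ⟨hij.symm, hj⟩
  rw [← Finset.add_sum_erase s f hi, ← Finset.add_sum_erase s g hi,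
    ← Finset.add_sum_erase _ f hj', ← Finset.add_sum_erase _ g hj']
  have : ∑ t ∈ (s.erase i).erase j, f t = ∑ t ∈ (s.erase i).erase j, g t := by
    refine Finset.sum_congr rfl fun t ht => ?_
    simp only [Finset.mem_erase] at ht
    exact h' t ht.2.1 ht.1
  omega

/-- The sum of the lengths of the images of the generators other than the first one. -/
def tailNorm (β : BraidGroup n) : ℕ := ∑ t ∈ Finset.Ico 1 n, norm (act β (of t))

/-- A cancelled distinguished letter allows a generator or its inverse to swap two neighbouring
arcs, replacing the longer one by a conjugate with a strictly shorter conjugator. Since `t ≥ 1`,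
this generator lies in the tail subgroup. -/
theorem noCancel_of_minimal {β : BraidGroup n} {u : ℕ → List (ℕ × Bool)} {k : ℕ → ℕ}
    (hu : ∀ t, (act β (of t)).toWord = u t ++ (k t, true) :: invRev (u t))
    (hmin : ∀ h ∈ tailSubgroup n, tailNorm β ≤ tailNorm (β * h)) {t : ℕ} (h1 : 1 ≤ t)
    (ht : t + 1 < n) : NoCancel u k t := by
  have htn : t < n - 1 := by omega
  have hs := sgen_mem_tailSubgroup h1 htn
  have hconj := fun t => eq_conj_of_toWord (hu t)
  have hnorm := fun t => norm_of_toWord (hu t)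
  constructor
  · rintro ⟨v, hv⟩
    refine absurd (hmin _ hs) (not_le.2 ?_)
    refine sum_lt_sum_of_pair (i := t) (j := t + 1) (by simp; omega) (by simp; omega) (by omega)
      ?_ ?_
    · have e1 : act (β * sgen n t) (of t) =
          mk (u t ++ v) * of (k (t + 1)) * (mk (u t ++ v))⁻¹ := by
        rw [_root_.map_mul, MulAut.mul_apply, act_sgen htn, hurwitz_of_self, _root_.map_mul,
          _root_.map_mul, _root_.map_inv, hconj t, hconj (t + 1), ← hv]
        have : mk [(k t, false)] = (of (k t))⁻¹ := by simp [of, inv_mk, invRev]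
        simp only [← mul_mk, this]
        group
      have e2 : act (β * sgen n t) (of (t + 1)) = act β (of t) := by
        rw [_root_.map_mul, MulAut.mul_apply, act_sgen htn, hurwitz_of_succ]
      rw [e1, e2, hnorm t, hnorm (t + 1), ← hv]
      have := norm_conj_le (u t ++ v) (k (t + 1))
      simp only [List.length_append, List.length_singleton] at this ⊢
      omega
    · intro i hi hi'
      rw [_root_.map_mul, MulAut.mul_apply, act_sgen htn, hurwitz_of_ne hi hi']
  · rintro ⟨v, hv⟩
    refine absurd (hmin _ (inv_mem hs)) (not_le.2 ?_)
    have hinv : ∀ {g g'}, hurwitz t g' = g → act (β * (sgen n t)⁻¹) g = act β g' := by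
      rintro g g' rfl
      rw [_root_.map_mul, MulAut.mul_apply, _root_.map_inv, act_sgen htn, MulAut.inv_apply_self]
    refine sum_lt_sum_of_pair (i := t) (j := t + 1) (by simp; omega) (by simp; omega) (by omega)
      ?_ ?_
    · have e1 : act (β * (sgen n t)⁻¹) (of (t + 1)) =
          mk (u (t + 1) ++ v) * of (k t) * (mk (u (t + 1) ++ v))⁻¹ := by
        rw [hinv (g' := (of (t + 1))⁻¹ * of t * of (t + 1)) (by simp [mul_assoc]), _root_.map_mul,
          _root_.map_mul, _root_.map_inv, hconj t, hconj (t + 1), ← hv]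
        have : mk [(k (t + 1), true)] = of (k (t + 1)) := rfl
        simp only [← mul_mk, this]
        group
      have e2 : act (β * (sgen n t)⁻¹) (of t) = act β (of (t + 1)) := hinv (by simp)
      rw [e1, e2, hnorm t, hnorm (t + 1), ← hv]
      have := norm_conj_le (u (t + 1) ++ v) (k t)
      simp only [List.length_append, List.length_singleton] at this ⊢
      omega
    · intro i hi hi'
      rw [hinv (hurwitz_of_ne hi hi')]

theorem exists_minimal_tailNorm (β : BraidGroup n) : ∃ h ∈ tailSubgroup n,
    ∀ h' ∈ tailSubgroup n, tailNorm (β * h) ≤ tailNorm (β * h * h') := by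
  classical
  have hex : ∃ N, ∃ h ∈ tailSubgroup n, tailNorm (β * h) = N := ⟨_, 1, one_mem _, rfl⟩
  obtain ⟨h, hh, e⟩ := Nat.find_spec hex
  refine ⟨h, hh, fun h' hh' => ?_⟩
  rw [e]
  exact Nat.find_min' hex ⟨h * h', mul_mem hh hh', by rw [mul_assoc]⟩

/-- A braid which moves the first generator to an element starting with it is `σ₀`-positive. -/
theorem sigmaPos_of_startsZero (hn : 0 < n - 1) (β : BraidGroup n) (h0 : act β (of 0) ≠ of 0)
    (hs : StartsZero (act β (of 0))) : SigmaPos ⟨0, hn⟩ β := by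
  induction hN : norm (act β (of 0)) using Nat.strong_induction_on generalizing β with
  | _ N ih =>
  subst hN
  obtain ⟨h, hh, hmin⟩ := exists_minimal_tailNorm β
  have hact0 : act (β * h) (of 0) = act β (of 0) := by
    rw [_root_.map_mul, MulAut.mul_apply, act_zero_of_mem_tailSubgroup hh]
  -- Passing to the minimizer changes neither the image of x_0 nor σ_0-positivity.
  suffices H : SigmaPos ⟨0, hn⟩ (β * h) by
    simpa using H.mul_tail (inv_mem hh)
  rw [← hact0] at ih hs h0
  generalize β * h = β at *
  have step : ∀ p, SigmaPos ⟨0, hn⟩ p →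
      (act (β * p⁻¹) (of 0) = of 0 ∨ (StartsZero (act (β * p⁻¹) (of 0)) ∧
        norm (act (β * p⁻¹) (of 0)) < norm (act β (of 0)))) → SigmaPos ⟨0, hn⟩ β := by
    intro p hp hor
    by_cases h1 : act (β * p⁻¹) (of 0) = of 0
    · have := hp.tail_mul (mem_tailSubgroup_of_act_zero h1)
      simpa using this
    · have h2 := hor.resolve_left h1
      have := (ih _ h2.2 _ h1 h2.1 rfl).mul hp
      simpa using this
  have hex : ∀ t, ∃ (k : ℕ) (u : List (ℕ × Bool)),
      (act β (of t)).toWord = u ++ (k, true) :: invRev u := by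
    intro t
    obtain ⟨g, k, hg⟩ := exists_act_of_eq_conj β t
    exact ⟨k, by rw [hg]; exact exists_toWord_conj g k⟩
  choose k u hu using hex
  have hu0 : (u 0).head? = some (0, true) := by
    unfold StartsZero at hs
    rw [hu 0] at hs
    rcases hu0 : u 0 with - | ⟨p, v⟩
    · rw [hu0] at hs
      simp at hs
      refine (h0 ?_).elim
      rw [eq_conj_of_toWord (hu 0), hu0, hs]
      simp [← one_eq_mk]
    · rw [hu0] at hs
      simpa using hs
  rcases exists_reduction (by omega) (fun t _ => hu t)
    (fun t h1 h2 => noCancel_of_minimal hu hmin h1 h2)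
    (by rw [← map_seg, act_seg_of]) hu0 with ⟨v, hv⟩ | ⟨j, z, hj2, hjn, hz, hz0, hA⟩
  · refine step (sgen n 0) (sigmaPos_sgen_zero hn) ?_
    have h1 : act (β * (sgen n 0)⁻¹) (of 0) = act β (of 1) := by
      have : (hurwitz 0)⁻¹ (of 0) = of 1 := by
        rw [MulAut.inv_apply, MulEquiv.symm_apply_eq]
        exact (hurwitz_of_succ 0).symm
      rw [_root_.map_mul, MulAut.mul_apply, _root_.map_inv, act_sgen hn, this]
    rw [h1]
    rw [← hv] at hu0
    rcases hu1 : u 1 with - | ⟨p, v⟩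
    · left
      rw [hu1] at hu0
      simp at hu0
      rw [eq_conj_of_toWord (hu 1), hu1, hu0]
      simp [← one_eq_mk]
    · right
      refine ⟨?_, ?_⟩
      · unfold StartsZero
        rw [hu 1, hu1]
        rw [hu1] at hu0
        simpa using hu0
      · rw [norm_of_toWord (hu 0), norm_of_toWord (hu 1), ← hv]
        simp
  -- The factor split off turns the first strand once around the next `j - 1` strands. Its inverse
  -- conjugates x_0 by C⁻¹ with C = x_0 ⋯ x_{j-1}, which strips the prefix `act β C` from the arc.
  · obtain ⟨m, rfl⟩ : ∃ m, j = m + 1 + 1 := ⟨j - 2, by omega⟩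
    refine step (run n (m + 1) * revRun n (m + 1))
      ((sigmaPos_run (by omega)).mul (sigmaPos_revRun (by omega))) (Or.inr ?_)
    set C : FreeGroup ℕ := seg of 0 (m + 1 + 1) with hC
    have hm : m + 1 ≤ n - 1 := by omega
    have h1 : (act (run n (m + 1) * revRun n (m + 1)))⁻¹ (of 0) = C⁻¹ * of 0 * C := by
      rw [MulAut.inv_apply, MulEquiv.symm_apply_eq]
      have hfix : act (run n (m + 1) * revRun n (m + 1)) C = C := by
        rw [_root_.map_mul, MulAut.mul_apply, act_revRun_seg_of hm, act_run_seg_of hm]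
      rw [_root_.map_mul, _root_.map_mul, _root_.map_inv, hfix, act_run_mul_revRun_zero hm, ← hC]
      group
    have hAC : seg (fun t => act β (of t)) 0 (m + 1 + 1) = act β C := by rw [hC, map_seg]
    rw [hAC] at hz hA
    have h2 : act (β * (run n (m + 1) * revRun n (m + 1))⁻¹) (of 0) =
        mk (z ++ [(k 0, true)] ++ invRev z) := by
      rw [_root_.map_mul, MulAut.mul_apply, _root_.map_inv, h1, _root_.map_mul, _root_.map_mul,
        _root_.map_inv, eq_conj_of_toWord (hu 0), hz, ← mul_mk, mk_toWord, ← mul_mk, ← mul_mk,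
        ← inv_mk, of]
      group
    have hred : IsReduced (z ++ [(k 0, true)] ++ invRev z) := by
      have : IsReduced (act β (of 0)).toWord := isReduced_toWord
      rw [hu 0, hz] at this
      exact this.infix ⟨(act β C).toWord, invRev (act β C).toWord, by simp⟩
    have h3 := toWord_mk_of_isReduced hred
    rw [← h2] at h3
    refine ⟨?_, ?_⟩
    · unfold StartsZero
      rw [h3, List.append_assoc, List.head?_append, hz0]
      rfl
    · rw [norm_of_toWord (hu 0), FreeGroup.norm, h3, hz]
      have : 0 < (act β C).toWord.length :=
        List.length_pos_of_ne_nil fun h => hA (toWord_eq_nil_iff.1 h)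
      simp
      omega

end BraidGroup

/-! ### The Dehornoy order is a linear order -/

namespace BraidGroup

open FreeGroup HurwitzOrder

variable {n : ℕ}

theorem act_freeLT_iff (β : BraidGroup n) {g h : FreeGroup ℕ} :
    FreeLT (act β g) (act β h) ↔ FreeLT g h :=
  act_mem_orderAut β g h

/-- Every letter preserves the order; σ_i sends x_i strictly down, and the later letters fix x_i.
Thus one occurrence of σ_i makes the inequality strict. -/
theorem act_ofWord_le {i : Fin (n - 1)} : ∀ {L : List (Fin (n - 1) × Bool)}, (i, false) ∉ L →
    (∀ x ∈ L, i ≤ x.1) → (act (ofWord L) (of i) = of (i : ℕ) ∨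
      FreeLT (act (ofWord L) (of i)) (of i)) ∧
      ((i, true) ∈ L → FreeLT (act (ofWord L) (of i)) (of i))
  | [], _, _ => by simp [ofWord_nil]
  | (j, e) :: L, h1, h2 => by
    obtain ⟨ih1, ih2⟩ := act_ofWord_le (i := i) (L := L) (fun h => h1 (List.mem_cons_of_mem _ h))
      fun x hx => h2 x (List.mem_cons_of_mem _ hx)
    rw [ofWord_cons, _root_.map_mul, MulAut.mul_apply]
    dsimp only
    rcases eq_or_ne j i with rfl | hj
    · obtain rfl : e = true := by
        cases e
        · simp at h1
        · rfl
      have : FreeLT (act (gen j) (act (ofWord L) (of j))) (of j) := by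
        have h3 : FreeLT (act (gen j) (of (j : ℕ))) (of j) := by
          rw [act_gen]; exact freeLT_hurwitz_of_self j
        rcases ih1 with h | h
        · rwa [h]
        · exact ((act_freeLT_iff (gen j)).2 h).trans h3
      rw [if_pos rfl]
      exact ⟨Or.inr this, fun _ => this⟩
    · have hij : (i : ℕ) < j := by
        have := h2 (j, e) (by simp)
        exact lt_of_le_of_ne this fun h => hj (Fin.ext h.symm)
      have hfix : act (gen j) (of (i : ℕ)) = of (i : ℕ) := by
        rw [act_gen]; exact hurwitz_of_ne (by omega) (by omega)
      have hfix' : ∀ e : Bool, act (if e then gen j else (gen j)⁻¹) (of (i : ℕ)) = of (i : ℕ) := by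
        rintro (- | -)
        · rw [if_neg (by simp), _root_.map_inv, MulAut.inv_apply, MulEquiv.symm_apply_eq, hfix]
        · rw [if_pos rfl, hfix]
      have hlt : FreeLT (act (ofWord L) (of i)) (of i) →
          FreeLT (act (if e then gen j else (gen j)⁻¹) (act (ofWord L) (of i))) (of i) := by
        intro h
        rwa [← act_freeLT_iff (if e then gen j else (gen j)⁻¹), hfix'] at h
      refine ⟨ih1.imp (fun h => ?_) hlt, fun h => hlt (ih2 ?_)⟩
      · rw [h, hfix']
      · simpa [hj.symm] using h

/-- A `σ_i`-positive braid moves the `i`-th generator down. -/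
theorem SigmaPos.act_lt {i : Fin (n - 1)} {β : BraidGroup n} (h : SigmaPos i β) :
    FreeLT (act β (of i)) (of i) := by
  obtain ⟨L, ⟨h1, h2, h3⟩, rfl⟩ := h
  exact (act_ofWord_le h2 h3).2 h1

theorem not_dehornoyPos_one : ¬ DehornoyPos (1 : BraidGroup n) := by
  rintro ⟨i, h⟩
  have := SigmaPos.act_lt h
  rw [_root_.map_one] at this
  exact this.irrefl

/-- The embedding of the braid group on one strand less which omits the first strand. -/
def shift (m : ℕ) : BraidGroup (m + 1) →* BraidGroup (m + 2) :=
  PresentedGroup.toGroup (f := fun i : Fin (m + 1 - 1) => sgen (m + 2) (i + 1)) (by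
    rintro r (⟨i, j, h, rfl⟩ | ⟨i, j, h, rfl⟩)
    · simp only [_root_.map_mul, _root_.map_inv, lift_apply_of]
      rw [sgen_comm (by omega), mul_inv_cancel]
    · simp only [_root_.map_mul, _root_.map_inv, lift_apply_of]
      rw [← h, sgen_braid (by omega), mul_inv_cancel])

theorem shift_gen {m : ℕ} (i : Fin (m + 1 - 1)) : shift m (gen i) = sgen (m + 2) (i + 1) :=
  PresentedGroup.toGroup.of _

theorem tailSubgroup_le_range_shift (m : ℕ) : tailSubgroup (m + 2) ≤ (shift m).range := by
  refine (Subgroup.closure_le _).2 ?_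
  rintro _ ⟨j, h1, h2, rfl⟩
  obtain ⟨j, rfl⟩ : ∃ k, j = k + 1 := ⟨j - 1, by omega⟩
  exact ⟨gen ⟨j, by omega⟩, shift_gen _⟩

theorem DehornoyPos.shift {m : ℕ} {β : BraidGroup (m + 1)} (h : DehornoyPos β) :
    DehornoyPos (shift m β) := by
  obtain ⟨i, L, ⟨h1, h2, h3⟩, rfl⟩ := h
  let f : Fin (m + 1 - 1) → Fin (m + 2 - 1) := fun i => ⟨i + 1, by omega⟩
  have hf : ∀ {i j}, f i = f j → i = j := by
    intro i j h
    have := congrArg Fin.val h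
    exact Fin.ext (Nat.succ_injective this)
  refine ⟨f i, L.map fun x => (f x.1, x.2), ⟨?_, ?_, ?_⟩, ?_⟩
  · exact List.mem_map.2 ⟨_, h1, rfl⟩
  · intro h
    obtain ⟨⟨j, e⟩, hx, hx'⟩ := List.mem_map.1 h
    simp only [Prod.mk.injEq] at hx'
    rw [hf hx'.1, hx'.2] at hx
    exact h2 hx
  · intro x hx
    obtain ⟨y, hy, rfl⟩ := List.mem_map.1 hx
    exact Nat.succ_le_succ (h3 y hy)
  · rw [ofWord, ofWord, map_list_prod, List.map_map, List.map_map]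
    congr 1
    refine List.map_congr_left fun x _ => ?_
    have : BraidGroup.shift m (gen x.1) = gen (f x.1) := by
      rw [shift_gen, ← sgen_eq_gen]
    cases hx : x.2 <;> simp [hx, this]

/-- Either β fixes x_0 and comes from fewer strands, or β(x_0) starts with x_0, or x_0 < β(x_0). In
the last case β⁻¹(x_0) < x_0, which forces β⁻¹(x_0) to start with x_0. -/
theorem dehornoyPos_trichotomy_succ (m : ℕ) (β : BraidGroup (m + 1)) :
    β = 1 ∨ DehornoyPos β ∨ DehornoyPos β⁻¹ := by
  induction m with
  | zero =>
    left
    exact mem_of_sgen_mem (n := 0 + 1) ⊥ (fun i hi => by omega) β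
  | succ m ih =>
    have hn : 0 < m + 1 + 1 - 1 := by omega
    by_cases h0 : act β (of 0) = of 0
    · obtain ⟨γ, rfl⟩ := tailSubgroup_le_range_shift m (mem_tailSubgroup_of_act_zero h0)
      rcases ih γ with rfl | h | h
      · exact Or.inl (_root_.map_one _)
      · exact Or.inr (Or.inl h.shift)
      · exact Or.inr (Or.inr (by simpa using h.shift))
    by_cases hs : StartsZero (act β (of 0))
    · exact Or.inr (Or.inl (sigmaPos_of_startsZero hn β h0 hs).dehornoyPos)
    · have hne : act β (of 0) ≠ 1 := fun h => of_ne_one 0 (by simp at h)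
      have h1 := freeLT_of_zero hne hs
      rw [← act_freeLT_iff β⁻¹, ← MulAut.mul_apply, ← _root_.map_mul, inv_mul_cancel,
        _root_.map_one, MulAut.one_apply] at h1
      refine Or.inr (Or.inr (sigmaPos_of_startsZero hn β⁻¹ (fun h => ?_)
        (startsZero_of_freeLT h1)).dehornoyPos)
      rw [h] at h1
      exact h1.irrefl

theorem dehornoyPos_trichotomy (hn : 0 < n) (β : BraidGroup n) :
    β = 1 ∨ DehornoyPos β ∨ DehornoyPos β⁻¹ := by
  obtain ⟨m, rfl⟩ := Nat.exists_eq_succ_of_ne_zero hn.ne'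
  exact dehornoyPos_trichotomy_succ m β

/-- Artin's representation is faithful. -/
theorem eq_one_of_act_eq_one (hn : 0 < n) {β : BraidGroup n} (h : act β = 1) : β = 1 := by
  have key : ∀ γ : BraidGroup n, act γ = 1 → ¬ DehornoyPos γ := by
    rintro γ hγ ⟨i, hi⟩
    have := SigmaPos.act_lt hi
    rw [hγ] at this
    exact this.irrefl
  rcases dehornoyPos_trichotomy hn β with h' | h' | h'
  · exact h'
  · exact (key _ h h').elim
  · exact (key _ (by rw [_root_.map_inv, h, inv_one]) h').elim

/-- The braids which do not move any element of the free group up. -/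
def descending (n : ℕ) : Submonoid (BraidGroup n) where
  carrier := {γ | ∀ g, act γ g = g ∨ FreeLT (act γ g) g}
  one_mem' g := Or.inl (by simp)
  mul_mem' {α β} hα hβ g := by
    rw [_root_.map_mul, MulAut.mul_apply]
    rcases hβ g with h | h
    · rw [h]; exact hα g
    · rcases hα (act β g) with h' | h'
      · rw [h']; exact Or.inr h
      · exact Or.inr (h'.trans h)

theorem gen_mem_descending (i : Fin (n - 1)) : gen i ∈ descending n := fun g => by
  rw [act_gen]; exact hurwitz_le i g

theorem sgen_mem_descending (i : ℕ) : sgen n i ∈ descending n := by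
  unfold sgen
  split_ifs
  · exact gen_mem_descending _
  · exact one_mem _

theorem conj_mem_descending {γ : BraidGroup n} (h : γ ∈ descending n) (w : BraidGroup n) :
    w * γ * w⁻¹ ∈ descending n := by
  intro g
  rw [_root_.map_mul, _root_.map_mul, MulAut.mul_apply, MulAut.mul_apply]
  have e : act w (act w⁻¹ g) = g := by
    rw [_root_.map_inv, MulAut.apply_inv_self]
  refine (h (act w⁻¹ g)).imp (fun h => by rw [h, e]) fun h => ?_
  rwa [← act_freeLT_iff w, e] at h

/-- If γ⁻¹ were positive, it would move some x_i down, and γ would move that x_i up. -/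
theorem dehornoyPos_of_mem_descending (hn : 0 < n) {γ : BraidGroup n} (h : γ ∈ descending n)
    (h1 : γ ≠ 1) : DehornoyPos γ := by
  rcases dehornoyPos_trichotomy hn γ with h' | h' | ⟨i, h'⟩
  · exact (h1 h').elim
  · exact h'
  · have h2 := SigmaPos.act_lt h'
    rw [← act_freeLT_iff γ, ← MulAut.mul_apply, ← _root_.map_mul, mul_inv_cancel,
      _root_.map_one, MulAut.one_apply] at h2
    rcases h (of i) with h3 | h3
    · rw [h3] at h2
      exact h2.irrefl.elim
    · exact (h2.asymm h3).elim

end BraidGroup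

/-! ### The full twist -/

namespace BraidGroup

open FreeGroup HurwitzOrder

variable {n : ℕ}

/-- The half twist on the first `k + 1` strands. -/
def halfTwist (n : ℕ) : ℕ → BraidGroup n
  | 0 => 1
  | k + 1 => run n (k + 1) * halfTwist n k

theorem prod_map_finRange {G : Type*} [Group G] (f : ℕ → G) (N : ℕ) :
    ((List.finRange N).map fun i : Fin N => f i).prod = seg f 0 N := by
  induction N with
  | zero => rfl
  | succ N ih =>
    rw [List.finRange_succ_last, seg_succ_right, ← ih, List.map_append, List.prod_append,
      List.map_map]
    simp [Function.comp_def]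

theorem prod_map_filter {ι G : Type*} [Group G] (p : ι → Prop) [DecidablePred p] (f : ι → G)
    (l : List ι) : ((l.filter p).map f).prod = (l.map fun i => if p i then f i else 1).prod := by
  induction l with
  | nil => rfl
  | cons a l ih => by_cases h : p a <;> simp [h, ih]

theorem prod_filter_gen (k : Fin (n - 1)) :
    (((List.finRange (n - 1)).filter fun i => i ≤ k).map gen).prod = run n (k + 1) := by
  rw [prod_map_filter (fun i => i ≤ k)]
  have h1 := prod_map_finRange (fun i => if i ≤ (k : ℕ) then sgen n i else 1) (n - 1)
  simp only [sgen_eq_gen, Fin.val_fin_le] at h1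
  rw [h1]
  obtain ⟨l, hl⟩ : ∃ l, n - 1 = k + 1 + l := ⟨n - 1 - (k + 1), by omega⟩
  have h2 : ∀ j m, (k : ℕ) < j → seg (fun i => if i ≤ (k : ℕ) then sgen n i else 1) j m = 1 := by
    intro j m hj
    induction m generalizing j with
    | zero => rfl
    | succ m ih => rw [seg_succ, ih _ (by omega), if_neg (by omega), mul_one]
  refine (congrArg (seg _ 0) hl).trans ?_
  rw [seg_add, h2 (0 + (k + 1)) l (by omega), mul_one, run]
  exact seg_congr fun j _ hj => if_pos (by omega)

theorem garside_eq_halfTwist : garside n = halfTwist n (n - 1) := by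
  have key : ∀ N, ((List.finRange N).reverse.map fun k : Fin N => run n (k + 1)).prod = halfTwist n N := by
    intro N
    induction N with
    | zero => rfl
    | succ N ih =>
      rw [List.finRange_succ_last, halfTwist, ← ih, List.reverse_append, List.map_append,
        List.prod_append, ← List.map_reverse, List.map_map]
      simp [Function.comp_def]
  rw [← key, garside]
  simp only [prod_filter_gen]

theorem act_run_of {k i : ℕ} (hk : k ≤ n - 1) (hi : i < k) :
    act (run n k) (of i) = of 0 * of (i + 1) * (of 0)⁻¹ := by
  rw [act_run hk, seg_hurwitz_of]
  simp [hi]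

theorem act_run_of_self {k : ℕ} (hk : k ≤ n - 1) : act (run n k) (of k) = of 0 := by
  rw [act_run hk, seg_hurwitz_of]
  simp

theorem act_run_of_gt {k i : ℕ} (hk : k ≤ n - 1) (hi : k < i) : act (run n k) (of i) = of i := by
  rw [act_run hk, seg_hurwitz_of]
  rw [if_neg (by omega), if_neg (by omega)]

theorem act_run_seg {k j : ℕ} (hk : k ≤ n - 1) (hj : j ≤ k) :
    act (run n k) (seg of 0 j) = seg of 0 (j + 1) * (of 0)⁻¹ := by
  induction j with
  | zero => simp [seg_one, seg_zero]
  | succ j ih =>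
    rw [seg_succ_right, _root_.map_mul, ih (by omega), zero_add, act_run_of hk (by omega),
      seg_succ_right of 0 (j + 1), zero_add]
    group

theorem act_halfTwist_of {k i : ℕ} (hk : k ≤ n - 1) (hi : i ≤ k) : act (halfTwist n k) (of i) =
    seg of 0 (k - i) * of (k - i) * (seg of 0 (k - i))⁻¹ := by
  induction k generalizing i with
  | zero =>
    obtain rfl : i = 0 := by omega
    simp [halfTwist, seg_zero]
  | succ k ih =>
    rw [halfTwist, _root_.map_mul, MulAut.mul_apply]
    rcases Nat.lt_or_ge k i with h | h
    · obtain rfl : i = k + 1 := by omega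
      have : act (halfTwist n k) (of (k + 1)) = of (k + 1) := by
        have : ∀ j ≤ k, act (halfTwist n j) (of (k + 1)) = of (k + 1) := by
          intro j hj
          induction j with
          | zero => simp [halfTwist]
          | succ j ihj =>
            rw [halfTwist, _root_.map_mul, MulAut.mul_apply, ihj (by omega),
              act_run_of_gt (by omega) (by omega)]
        exact this k le_rfl
      rw [this, act_run_of_self hk]
      simp [seg_zero]
    · rw [ih (by omega) h, _root_.map_mul, _root_.map_mul, _root_.map_inv,
        act_run_seg hk (by omega), act_run_of hk (by omega), show k + 1 - i = k - i + 1 by omega]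
      group

theorem act_halfTwist_of_gt {k i : ℕ} (hk : k ≤ n - 1) (hi : k < i) :
    act (halfTwist n k) (of i) = of i := by
  induction k with
  | zero => simp [halfTwist]
  | succ k ih =>
    rw [halfTwist, _root_.map_mul, MulAut.mul_apply, ih (by omega) (by omega),
      act_run_of_gt hk hi]

theorem act_halfTwist_seg {k j : ℕ} (hk : k ≤ n - 1) (hj : j ≤ k + 1) :
    act (halfTwist n k) (seg of 0 j) = seg of 0 (k + 1) * (seg of 0 (k + 1 - j))⁻¹ := by
  induction j with
  | zero => simp [seg_zero]
  | succ j ih =>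
    rw [seg_succ_right, _root_.map_mul, ih (by omega), zero_add, act_halfTwist_of hk (by omega),
      show k + 1 - j = k - j + 1 by omega, show k + 1 - (j + 1) = k - j by omega,
      seg_succ_right of 0 (k - j), zero_add]
    group

/-- The full twist `Δ²`. -/
def fullTwist (n : ℕ) : BraidGroup n := garside n ^ 2

theorem act_fullTwist_of {i : ℕ} (hi : i < n) : act (fullTwist n) (of i) =
    seg of 0 n * of i * (seg of 0 n)⁻¹ := by
  have h1 : i ≤ n - 1 := by omega
  rw [fullTwist, garside_eq_halfTwist, pow_two, _root_.map_mul, MulAut.mul_apply,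
    act_halfTwist_of le_rfl h1, _root_.map_mul, _root_.map_mul, _root_.map_inv,
    act_halfTwist_seg le_rfl (by omega), act_halfTwist_of le_rfl (by omega),
    show n - 1 - (n - 1 - i) = i by omega, show n - 1 + 1 - (n - 1 - i) = i + 1 by omega,
    show n - 1 + 1 = n by omega, seg_succ_right, zero_add]
  group

theorem act_fullTwist_of_ge {i : ℕ} (hi : n ≤ i) (hn : 0 < n) :
    act (fullTwist n) (of i) = of i := by
  rw [fullTwist, garside_eq_halfTwist, pow_two, _root_.map_mul, MulAut.mul_apply,
    act_halfTwist_of_gt le_rfl (by omega), act_halfTwist_of_gt le_rfl (by omega)]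

/-- On the first `n` generators the full twist is conjugation by the boundary loop, which σ_i fixes;
it fixes the later ones. -/
theorem act_fullTwist_comm {i : ℕ} (hi : i < n - 1) :
    act (fullTwist n * sgen n i) = act (sgen n i * fullTwist n) := by
  refine mulAut_ext fun j => ?_
  rw [_root_.map_mul, _root_.map_mul, MulAut.mul_apply, MulAut.mul_apply, act_sgen hi]
  have hC : hurwitz i (seg of 0 n) = seg of 0 n := hurwitz_seg_of (by omega)
  rcases Nat.lt_or_ge j n with hj | hj
  · rw [act_fullTwist_of hj, _root_.map_mul, _root_.map_mul, _root_.map_inv, hC]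
    rcases eq_or_ne j i with rfl | h1
    · rw [hurwitz_of_self, _root_.map_mul, _root_.map_mul, _root_.map_inv, act_fullTwist_of hj,
        act_fullTwist_of (by omega)]
      group
    rcases eq_or_ne j (i + 1) with rfl | h2
    · rw [hurwitz_of_succ, act_fullTwist_of (by omega)]
    · rw [hurwitz_of_ne h1 h2, act_fullTwist_of hj]
  · rw [act_fullTwist_of_ge hj (by omega), hurwitz_of_ne (by omega) (by omega),
      act_fullTwist_of_ge hj (by omega)]

/-- The full twist is central. -/
theorem commute_fullTwist (hn : 0 < n) (β : BraidGroup n) : Commute (fullTwist n) β := by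
  have : β ∈ Subgroup.centralizer {fullTwist n} := mem_of_sgen_mem _ (fun i hi => by
    rw [Subgroup.mem_centralizer_singleton_iff]
    have := act_fullTwist_comm hi
    rw [← mul_inv_eq_one, ← _root_.map_inv, ← _root_.map_mul] at this
    exact (mul_inv_eq_one.1 (eq_one_of_act_eq_one hn this)).symm) β
  exact (Subgroup.mem_centralizer_singleton_iff.1 this).symm

theorem seg_mem_descending (j k : ℕ) : seg (sgen n) j k ∈ descending n := by
  induction k generalizing j with
  | zero => exact one_mem _
  | succ k ih => exact mul_mem (sgen_mem_descending j) (ih _)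

theorem halfTwist_mem_descending (k : ℕ) : halfTwist n k ∈ descending n := by
  induction k with
  | zero => exact one_mem _
  | succ k ih => exact mul_mem (seg_mem_descending _ _) ih

/-- The half twist is a positive word beginning with σ_0; deleting that letter leaves a positive
word. -/
theorem sgen_zero_inv_mul_fullTwist_mem_descending (hn : 1 < n) :
    (sgen n 0)⁻¹ * fullTwist n ∈ descending n := by
  rw [fullTwist, garside_eq_halfTwist, pow_two]
  obtain ⟨k, hk⟩ : ∃ k, n - 1 = k + 1 := ⟨n - 2, by omega⟩
  rw [show halfTwist n (n - 1) = halfTwist n (k + 1) from congrArg _ hk]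
  nth_rewrite 1 [halfTwist]
  rw [run, seg_succ, mul_assoc, mul_assoc, inv_mul_cancel_left, ← mul_assoc]
  exact mul_mem (mul_mem (seg_mem_descending _ _) (halfTwist_mem_descending _))
    (halfTwist_mem_descending _)

/-- All Artin generators are conjugate. -/
theorem isConj_sgen {i j : ℕ} (hi : i < n - 1) (hj : j < n - 1) : IsConj (sgen n i) (sgen n j) := by
  have key : ∀ i < n - 1, IsConj (sgen n 0) (sgen n i) := by
    intro i hi
    induction i with
    | zero => exact IsConj.refl _
    | succ i ih =>
      refine (ih (by omega)).trans (isConj_iff.2 ⟨sgen n i * sgen n (i + 1), ?_⟩)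
      rw [sgen_braid hi]
      group
  exact (key i hi).symm.trans (key j hj)

theorem conj_inv_mul_fullTwist_mem_descending (w : BraidGroup n) (i : Fin (n - 1)) :
    (w * gen i * w⁻¹)⁻¹ * fullTwist n ∈ descending n := by
  have hi := i.2
  obtain ⟨c, hc⟩ := isConj_iff.1 (isConj_sgen (n := n) (i := 0) (by omega) hi)
  have h1 := conj_mem_descending (sgen_zero_inv_mul_fullTwist_mem_descending (n := n) (by omega))
    (w * c)
  rw [sgen_eq_gen] at hc
  have h2 := (commute_fullTwist (n := n) (by omega) (w * c)).eq
  convert h1 using 1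
  rw [← hc]
  calc (w * (c * sgen n 0 * c⁻¹) * w⁻¹)⁻¹ * fullTwist n
      = w * c * (sgen n 0)⁻¹ * (w * c)⁻¹ * fullTwist n := by group
    _ = w * c * (sgen n 0)⁻¹ * (w * c)⁻¹ * (fullTwist n * (w * c)) * (w * c)⁻¹ := by group
    _ = _ := by rw [h2]; group

theorem sigmaPos_halfTwist {hn : 0 < n - 1} {k : ℕ} (hk : k + 1 ≤ n - 1) :
    SigmaPos ⟨0, hn⟩ (halfTwist n (k + 1)) := by
  induction k with
  | zero => simpa [halfTwist] using sigmaPos_run (hn := hn) hk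
  | succ k ih => exact (sigmaPos_run hk).mul (ih (by omega))

theorem sigmaPos_fullTwist (hn : 0 < n - 1) : SigmaPos ⟨0, hn⟩ (fullTwist n) := by
  obtain ⟨k, hk⟩ : ∃ k, n - 1 = k + 1 := ⟨n - 2, by omega⟩
  rw [fullTwist, garside_eq_halfTwist, pow_two,
    show halfTwist n (n - 1) = halfTwist n (k + 1) from congrArg _ hk]
  have := sigmaPos_halfTwist (hn := hn) hk.ge
  exact this.mul this

/-- All powers of σ_1 lie below one full twist. This is what saves one power of Δ² per factor β in
the final estimate. -/
theorem dehornoyPos_sgen_one_pow_inv_mul_fullTwist (hn : 3 ≤ n) (k : ℕ) :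
    DehornoyPos ((sgen n 1 ^ k)⁻¹ * fullTwist n) :=
  ((sigmaPos_fullTwist (by omega)).tail_mul
    (inv_mem (pow_mem (sgen_mem_tailSubgroup le_rfl (by omega)) k))).dehornoyPos

end BraidGroup

/-! ### The Dehornoy floor -/

namespace BraidGroup

variable {n : ℕ}

/-- The bi-invariant partial order of braids given by the descending braids. -/
def DescLE (α β : BraidGroup n) : Prop := α⁻¹ * β ∈ descending n

theorem DescLE.refl (α : BraidGroup n) : DescLE α α := by
  rw [DescLE, inv_mul_cancel]; exact one_mem _

theorem DescLE.trans {α β γ : BraidGroup n} (h1 : DescLE α β) (h2 : DescLE β γ) : DescLE α γ := by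
  have := mul_mem h1 h2
  rwa [mul_assoc, mul_inv_cancel_left] at this

/-- Conjugation invariance of `descending` allows inequalities to be multiplied, whereas Dehornoy's
order is only left-invariant. -/
theorem DescLE.mul {α β γ δ : BraidGroup n} (h1 : DescLE α β) (h2 : DescLE γ δ) :
    DescLE (α * γ) (β * δ) := by
  have h3 := mul_mem (conj_mem_descending h1 γ⁻¹) h2
  rw [DescLE]
  convert h3 using 1
  group

theorem DescLE.pow {α β : BraidGroup n} (h : DescLE α β) (k : ℕ) : DescLE (α ^ k) (β ^ k) := by
  induction k with
  | zero => rw [pow_zero, pow_zero]; exact DescLE.refl _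
  | succ k ih => rw [pow_succ, pow_succ]; exact ih.mul h

theorem DescLE.inv {α β : BraidGroup n} (h : DescLE α β) : DescLE β⁻¹ α⁻¹ := by
  have := conj_mem_descending h α
  rw [DescLE]
  convert this using 1
  group

theorem DehornoyLT.trans {α β γ : BraidGroup n} (h1 : DehornoyLT α β) (h2 : DehornoyLT β γ) :
    DehornoyLT α γ := by
  have := DehornoyPos.mul h1 h2
  rwa [mul_assoc, mul_inv_cancel_left] at this

theorem DehornoyLT.irrefl (α : BraidGroup n) : ¬ DehornoyLT α α := by
  rw [DehornoyLT, inv_mul_cancel]; exact not_dehornoyPos_one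

theorem DehornoyLE.trans_lt {α β γ : BraidGroup n} (h1 : DehornoyLE α β) (h2 : DehornoyLT β γ) :
    DehornoyLT α γ := by
  rcases h1 with rfl | h1
  · exact h2
  · exact h1.trans h2

theorem dehornoyLE_or_lt (hn : 0 < n) (α β : BraidGroup n) : DehornoyLE α β ∨ DehornoyLT β α := by
  rcases dehornoyPos_trichotomy hn (α⁻¹ * β) with h | h | h
  · exact Or.inl (Or.inl (inv_mul_eq_one.1 h))
  · exact Or.inl (Or.inr h)
  · rw [mul_inv_rev, inv_inv] at h
    exact Or.inr h

theorem DescLE.dehornoyLE (hn : 0 < n) {α β : BraidGroup n} (h : DescLE α β) : DehornoyLE α β := by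
  by_cases h1 : α⁻¹ * β = 1
  · exact Or.inl (inv_mul_eq_one.1 h1)
  · exact Or.inr (dehornoyPos_of_mem_descending hn h h1)

theorem conj_descLE_fullTwist (w : BraidGroup n) (i : Fin (n - 1)) :
    DescLE (w * gen i * w⁻¹) (fullTwist n) :=
  conj_inv_mul_fullTwist_mem_descending w i

theorem one_descLE_conj (w : BraidGroup n) (i : Fin (n - 1)) : DescLE 1 (w * gen i * w⁻¹) := by
  rw [DescLE, inv_one, one_mul]
  exact conj_mem_descending (gen_mem_descending i) w

/-- Every braid is dominated by a power of the full twist. -/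
theorem exists_descLE_fullTwist_pow (β : BraidGroup n) : ∃ c : ℕ, DescLE β (fullTwist n ^ c) := by
  let K : Subgroup (BraidGroup n) :=
    { carrier := {β | (∃ c : ℕ, DescLE β (fullTwist n ^ c)) ∧ ∃ c : ℕ, DescLE β⁻¹ (fullTwist n ^ c)}
      mul_mem' := by
        rintro α β ⟨⟨a, ha⟩, a', ha'⟩ ⟨⟨b, hb⟩, b', hb'⟩
        refine ⟨⟨a + b, ?_⟩, b' + a', ?_⟩
        · rw [pow_add]; exact ha.mul hb
        · rw [pow_add, mul_inv_rev]; exact hb'.mul ha'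
      one_mem' := ⟨⟨0, by simpa using DescLE.refl 1⟩, 0, by simpa using DescLE.refl 1⟩
      inv_mem' := by
        rintro β ⟨hb, hb'⟩
        exact ⟨hb', by rwa [inv_inv]⟩ }
  have : β ∈ K := mem_of_sgen_mem K (fun i hi => by
    have h1 := conj_descLE_fullTwist 1 ⟨i, hi⟩
    have h2 := (one_descLE_conj 1 ⟨i, hi⟩).inv
    rw [← sgen_eq_gen, one_mul, inv_one, mul_one] at h1 h2
    exact ⟨⟨1, by rwa [pow_one]⟩, 0, by rwa [pow_zero]⟩) β
  exact this.1

theorem fullTwist_zpow_lt_iff (hn : 3 ≤ n) {a b : ℤ} :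
    DehornoyLT (fullTwist n ^ a) (fullTwist n ^ b) ↔ a < b := by
  have key : ∀ {a b : ℤ}, a < b → DehornoyLT (fullTwist n ^ a) (fullTwist n ^ b) := by
    intro a b h
    obtain ⟨k, rfl⟩ : ∃ k : ℕ, b = a + (k + 1) := ⟨(b - a - 1).toNat, by omega⟩
    have hT : DehornoyPos (fullTwist n) := (sigmaPos_fullTwist (by omega)).dehornoyPos
    have hk : ∀ k : ℕ, DehornoyPos (fullTwist n ^ (k + 1)) := by
      intro k
      induction k with
      | zero => simpa using hT
      | succ k ih => rw [pow_succ]; exact ih.mul hT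
    have := hk k
    rw [DehornoyLT, zpow_add, inv_mul_cancel_left]
    exact_mod_cast this
  refine ⟨fun h => ?_, key⟩
  by_contra h'
  rcases (not_lt.1 h').eq_or_lt with rfl | h'
  · exact DehornoyLT.irrefl _ h
  · exact DehornoyLT.irrefl _ (h.trans (key h'))

theorem garside_zpow (k : ℤ) : garside n ^ (2 * k) = fullTwist n ^ k := by
  rw [zpow_mul]; rfl

/-- Inversion need not reverse a left-invariant order; it does here because the full twist is
central. -/
theorem DehornoyLT.inv_of_zpow (hn : 0 < n) {β : BraidGroup n} {a : ℤ}
    (h : DehornoyLT β (fullTwist n ^ a)) : DehornoyLT (fullTwist n ^ (-a)) β⁻¹ := by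
  have hc := ((commute_fullTwist hn β).zpow_left a).inv_right.eq
  rw [DehornoyLT, zpow_neg, inv_inv, hc]
  exact h

theorem exists_lt_zpow (hn : 3 ≤ n) (β : BraidGroup n) :
    ∃ c : ℤ, DehornoyLT β (fullTwist n ^ c) := by
  obtain ⟨c, hc⟩ := exists_descLE_fullTwist_pow β
  refine ⟨c + 1, (hc.dehornoyLE (by omega)).trans_lt ?_⟩
  rw [← zpow_natCast]
  exact (fullTwist_zpow_lt_iff hn).2 (by omega)

/-- The Dehornoy floor is well defined. -/
theorem isDehornoyFloor_dehornoyFloor (hn : 3 ≤ n) (β : BraidGroup n) :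
    IsDehornoyFloor β (dehornoyFloor β) := by
  have hn' : 0 < n := by omega
  have hset : {k : ℤ | DehornoyLE (garside n ^ (2 * k)) β} =
      {k : ℤ | DehornoyLE (fullTwist n ^ k) β} := by
    simp only [garside_zpow]
  obtain ⟨c, hc⟩ := exists_lt_zpow hn β
  obtain ⟨d, hd⟩ := exists_lt_zpow hn β⁻¹
  have hd' := hd.inv_of_zpow hn'
  rw [inv_inv] at hd'
  have hne : {k : ℤ | DehornoyLE (fullTwist n ^ k) β}.Nonempty := ⟨-d, Or.inr hd'⟩
  have hbdd : BddAbove {k : ℤ | DehornoyLE (fullTwist n ^ k) β} := by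
    refine ⟨c, fun k hk => ?_⟩
    exact ((fullTwist_zpow_lt_iff hn).1 (DehornoyLE.trans_lt hk hc)).le
  have hmem := Int.csSup_mem hne hbdd
  rw [IsDehornoyFloor, dehornoyFloor, hset, ← mul_add_one, garside_zpow, garside_zpow]
  refine ⟨hmem, ?_⟩
  rcases dehornoyLE_or_lt hn' (fullTwist n ^ (sSup {k : ℤ | DehornoyLE (fullTwist n ^ k) β} + 1)) β
    with h | h
  · have := le_csSup hbdd h
    omega
  · exact h

theorem zpow_floor_le (hn : 3 ≤ n) (β : BraidGroup n) :
    DehornoyLE (fullTwist n ^ dehornoyFloor β) β := by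
  rw [← garside_zpow]
  exact (isDehornoyFloor_dehornoyFloor hn β).1

theorem lt_zpow_floor (hn : 3 ≤ n) (β : BraidGroup n) :
    DehornoyLT β (fullTwist n ^ (dehornoyFloor β + 1)) := by
  rw [← garside_zpow, mul_add_one]
  exact (isDehornoyFloor_dehornoyFloor hn β).2

theorem dehornoyFloor_lt (hn : 3 ≤ n) {β : BraidGroup n} {a : ℤ}
    (h : DehornoyLT β (fullTwist n ^ a)) : dehornoyFloor β < a :=
  (fullTwist_zpow_lt_iff hn).1 ((zpow_floor_le hn β).trans_lt h)

theorem le_dehornoyFloor (hn : 3 ≤ n) {β : BraidGroup n} {a : ℤ}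
    (h : DehornoyLE (fullTwist n ^ a) β) : a ≤ dehornoyFloor β := by
  have := (fullTwist_zpow_lt_iff hn).1 (h.trans_lt (lt_zpow_floor hn β))
  omega

theorem DehornoyLE.mul_zpow (hn : 0 < n) {α β : BraidGroup n} {a b : ℤ}
    (h1 : DehornoyLE (fullTwist n ^ a) α) (h2 : DehornoyLE (fullTwist n ^ b) β) :
    DehornoyLE (fullTwist n ^ (a + b)) (α * β) := by
  have e : (fullTwist n ^ (a + b))⁻¹ * (α * β) =
      ((fullTwist n ^ a)⁻¹ * α) * ((fullTwist n ^ b)⁻¹ * β) := by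
    have hc := ((commute_fullTwist hn α).zpow_left b).inv_left.eq
    rw [add_comm, zpow_add, mul_inv_rev, mul_assoc, ← mul_assoc _ α β, hc]
    group
  have h : ∀ {γ δ : BraidGroup n}, DehornoyLE γ δ ↔ γ⁻¹ * δ = 1 ∨ DehornoyPos (γ⁻¹ * δ) := by
    intro γ δ
    rw [inv_mul_eq_one]; rfl
  rw [h] at h1 h2 ⊢
  rw [e]
  rcases h1 with h1 | h1
  · rwa [h1, one_mul]
  rcases h2 with h2 | h2
  · rw [h2, mul_one]; exact Or.inr h1
  · exact Or.inr (h1.mul h2)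

/-- The Dehornoy floor is superadditive. -/
theorem dehornoyFloor_add_le (hn : 3 ≤ n) (α β : BraidGroup n) :
    dehornoyFloor α + dehornoyFloor β ≤ dehornoyFloor (α * β) :=
  le_dehornoyFloor hn ((zpow_floor_le hn α).mul_zpow (by omega) (zpow_floor_le hn β))

/-! ### Products of conjugates of generators -/

/-- The braid `(w σ_i w⁻¹) ^ ε`. -/
def syllable (x : BraidGroup n × Fin (n - 1) × ℤˣ) : BraidGroup n :=
  (x.1 * gen x.2.1 * x.1⁻¹) ^ (x.2.2 : ℤ)

/-- The number of syllables of sign `e`. -/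
def signCount (e : ℤˣ) (l : List (BraidGroup n × Fin (n - 1) × ℤˣ)) : ℕ :=
  l.countP fun x => x.2.2 = e

theorem prod_syllable_descLE (l : List (BraidGroup n × Fin (n - 1) × ℤˣ)) :
    DescLE (l.map syllable).prod (fullTwist n ^ signCount 1 l) := by
  induction l with
  | nil => simpa [signCount] using DescLE.refl 1
  | cons x l ih =>
    obtain ⟨w, i, e⟩ := x
    rw [List.map_cons, List.prod_cons]
    rcases Int.units_eq_one_or e with rfl | rfl
    · have := (conj_descLE_fullTwist w i).mul ih
      rw [← pow_succ'] at this
      simpa [syllable, signCount] using this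
    · have := (one_descLE_conj w i).inv.mul ih
      rw [inv_one, one_mul] at this
      simpa [syllable, signCount, -mul_inv_rev] using this

/-- The first positive syllable is kept, the other positive ones are replaced by Δ² and the negative
ones by 1. -/
theorem prod_syllable_descLE_conj (hn : 0 < n) (l : List (BraidGroup n × Fin (n - 1) × ℤˣ)) {p : ℕ}
    (hp : signCount 1 l = p + 1) :
    ∃ w i, DescLE (l.map syllable).prod (fullTwist n ^ p * (w * gen i * w⁻¹)) := by
  induction l with
  | nil => simp [signCount] at hp
  | cons x l ih =>
    obtain ⟨w, i, e⟩ := x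
    rw [List.map_cons, List.prod_cons]
    rcases Int.units_eq_one_or e with rfl | rfl
    · refine ⟨w, i, ?_⟩
      have h1 : signCount 1 l = p := by simpa [signCount] using hp
      have := (DescLE.refl (w * gen i * w⁻¹)).mul (prod_syllable_descLE l)
      rw [h1, ← ((commute_fullTwist hn (w * gen i * w⁻¹)).pow_left p).eq] at this
      simpa [syllable] using this
    · obtain ⟨w', i', h⟩ := ih (by simpa [signCount] using hp)
      refine ⟨w', i', ?_⟩
      have := (one_descLE_conj w i).inv.mul h
      rw [inv_one, one_mul] at this
      simpa [syllable, -mul_inv_rev] using this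

/-- The powers of a product of `p` positive and any number of negative syllables grow slower than the
powers of `Δ ^ (2 * (p - 1))`. -/
theorem exists_prod_syllable_pow_lt (hn : 3 ≤ n) (l : List (BraidGroup n × Fin (n - 1) × ℤˣ)) :
    ∃ c : ℕ, ∀ k : ℕ, DehornoyLT ((l.map syllable).prod ^ k)
      (fullTwist n ^ (((signCount 1 l - 1) * k + c : ℕ) : ℤ)) := by
  have hn' : 0 < n := by omega
  simp only [zpow_natCast]
  rcases hp : signCount 1 l with - | p
  -- Without positive syllables the truncated difference is 0 and all powers lie below 1, hence
  -- strictly below Δ².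
  · refine ⟨1, fun k => ?_⟩
    have h := (prod_syllable_descLE l).pow k
    rw [hp, pow_zero, one_pow] at h
    refine (h.dehornoyLE hn').trans_lt ?_
    have := (fullTwist_zpow_lt_iff hn (a := 0) (b := 1)).2 one_pos
    simpa using this
  · obtain ⟨w, i, h⟩ := prod_syllable_descLE_conj hn' l hp
    -- The kept syllable is rewritten as a conjugate of σ_1, so that its powers are conjugates of
    -- powers of σ_1. The conjugator and its inverse cost the constants `a` and `b`, and σ_1^k costs
    -- one more full twist.
    obtain ⟨v, hv⟩ := isConj_iff.1 (isConj_sgen (n := n) (i := 1) (by omega) i.2)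
    rw [sgen_eq_gen] at hv
    obtain ⟨a, ha⟩ := exists_descLE_fullTwist_pow (w * v)
    obtain ⟨b, hb⟩ := exists_descLE_fullTwist_pow (w * v)⁻¹
    refine ⟨a + b + 1, fun k => ?_⟩
    rw [Nat.add_sub_cancel]
    have hT : ∀ (q : ℕ) (β : BraidGroup n), Commute (fullTwist n ^ q) β :=
      fun q β => (commute_fullTwist hn' β).pow_left q
    have h1 := h.pow k
    have h2 : w * gen i * w⁻¹ = (w * v) * sgen n 1 * (w * v)⁻¹ := by rw [← hv]; group
    rw [(hT p _).mul_pow, h2, conj_pow, ← pow_mul] at h1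
    have h3 := h1.trans ((DescLE.refl _).mul ((ha.mul (DescLE.refl (sgen n 1 ^ k))).mul hb))
    refine (h3.dehornoyLE hn').trans_lt ?_
    have h4 := dehornoyPos_sgen_one_pow_inv_mul_fullTwist hn k
    rw [DehornoyLT]
    convert h4 using 1
    rw [(hT a _).eq, mul_assoc, ← pow_add, ← (hT (a + b) _).eq, ← mul_assoc, ← pow_add, mul_inv_rev,
      show p * k + (a + b + 1) = p * k + (a + b) + 1 by ring, pow_succ, mul_assoc,
      inv_mul_cancel_left]

theorem prod_syllable_inv (l : List (BraidGroup n × Fin (n - 1) × ℤˣ)) :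
    ((l.map syllable).prod)⁻¹ =
      ((l.reverse.map fun x => (x.1, x.2.1, -x.2.2)).map syllable).prod := by
  rw [List.prod_inv_reverse, List.map_map, List.map_map, ← List.map_reverse]
  congr 1
  refine List.map_congr_left fun x _ => ?_
  simp [syllable]

theorem signCount_reverse_neg (l : List (BraidGroup n × Fin (n - 1) × ℤˣ)) :
    signCount 1 (l.reverse.map fun x => (x.1, x.2.1, -x.2.2)) = signCount (-1) l := by
  unfold signCount
  rw [List.countP_map, List.countP_reverse]
  refine List.countP_congr fun x _ => ?_
  simp [neg_eq_iff_eq_neg]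

/-! ### The fractional Dehn twist coefficient -/

/-- Fekete's lemma for the negated floors, which are subadditive; the additive constants vanish
after division by `k`. -/
theorem tendsto_dehornoyFloor (hn : 3 ≤ n) (β : BraidGroup n) {q c q' c' : ℕ}
    (h1 : ∀ k : ℕ, dehornoyFloor (β ^ k) ≤ q * k + c)
    (h2 : ∀ k : ℕ, -((q' : ℤ) * k + c') ≤ dehornoyFloor (β ^ k)) :
    Tendsto (fun k : ℕ => (dehornoyFloor (β ^ k) : ℝ) / (k : ℝ)) atTop (𝓝 (fdtc β)) ∧
      -(q' : ℝ) ≤ fdtc β ∧ fdtc β ≤ q := by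
  set u : ℕ → ℝ := fun k => -(dehornoyFloor (β ^ k) : ℝ) with hu
  have hsub : Subadditive u := by
    intro a b
    have := dehornoyFloor_add_le hn (β ^ a) (β ^ b)
    rw [← pow_add] at this
    have : ((dehornoyFloor (β ^ a) : ℝ)) + dehornoyFloor (β ^ b) ≤ dehornoyFloor (β ^ (a + b)) := by
      exact_mod_cast this
    simp only [hu]
    linarith
  have h1' : ∀ k : ℕ, 0 < k → (dehornoyFloor (β ^ k) : ℝ) / k ≤ q + c / k := by
    intro k hk
    have hk' : (0 : ℝ) < k := by exact_mod_cast hk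
    have : (dehornoyFloor (β ^ k) : ℝ) ≤ q * k + c := by exact_mod_cast h1 k
    rw [div_le_iff₀ hk', add_mul, div_mul_cancel₀ _ hk'.ne']
    exact this
  have h2' : ∀ k : ℕ, 0 < k → -(q' : ℝ) - c' / k ≤ (dehornoyFloor (β ^ k) : ℝ) / k := by
    intro k hk
    have hk' : (0 : ℝ) < k := by exact_mod_cast hk
    have : -((q' : ℝ) * k + c') ≤ (dehornoyFloor (β ^ k) : ℝ) := by exact_mod_cast h2 k
    rw [le_div_iff₀ hk', sub_mul, div_mul_cancel₀ _ hk'.ne']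
    linarith
  have hbdd : BddBelow (Set.range fun k => u k / k) := by
    refine ⟨-((q : ℝ) + c), ?_⟩
    rintro _ ⟨k, rfl⟩
    rcases k.eq_zero_or_pos with rfl | hk
    · have : (0 : ℝ) ≤ q + c := by positivity
      simp only [Nat.cast_zero, div_zero]
      linarith
    · have hk' : (1 : ℝ) ≤ k := by exact_mod_cast hk
      have h3 : (c : ℝ) / k ≤ c := div_le_self (by positivity) hk'
      have := h1' k hk
      simp only [hu, neg_div]
      linarith
  have hlim : Tendsto (fun k : ℕ => (dehornoyFloor (β ^ k) : ℝ) / (k : ℝ)) atTop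
      (𝓝 (-hsub.lim)) := by
    refine (hsub.tendsto_lim hbdd).neg.congr fun k => ?_
    simp [hu, neg_div]
  rw [show fdtc β = -hsub.lim from hlim.limUnder_eq]
  refine ⟨hlim, ?_, ?_⟩
  · have h3 : Tendsto (fun k : ℕ => -(q' : ℝ) - c' / k) atTop (𝓝 (-(q' : ℝ) - 0)) :=
      tendsto_const_nhds.sub (tendsto_const_div_atTop_nhds_zero_nat _)
    rw [sub_zero] at h3
    exact le_of_tendsto_of_tendsto h3 hlim ((eventually_gt_atTop 0).mono h2')
  · have h3 : Tendsto (fun k : ℕ => (q : ℝ) + c / k) atTop (𝓝 ((q : ℝ) + 0)) :=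
      tendsto_const_nhds.add (tendsto_const_div_atTop_nhds_zero_nat _)
    rw [add_zero] at h3
    exact le_of_tendsto_of_tendsto hlim h3 ((eventually_gt_atTop 0).mono h1')

theorem prod_syllable_fdtc (hn : 3 ≤ n) (l : List (BraidGroup n × Fin (n - 1) × ℤˣ)) :
    Tendsto (fun k : ℕ => (dehornoyFloor ((l.map syllable).prod ^ k) : ℝ) / (k : ℝ)) atTop
      (𝓝 (fdtc (l.map syllable).prod)) ∧
      -((signCount (-1) l - 1 : ℕ) : ℝ) ≤ fdtc (l.map syllable).prod ∧
      fdtc (l.map syllable).prod ≤ ((signCount 1 l - 1 : ℕ) : ℝ) := by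
  obtain ⟨c, hc⟩ := exists_prod_syllable_pow_lt hn l
  obtain ⟨c', hc'⟩ := exists_prod_syllable_pow_lt hn
    (l.reverse.map fun x => (x.1, x.2.1, -x.2.2))
  rw [signCount_reverse_neg, ← prod_syllable_inv] at hc'
  refine tendsto_dehornoyFloor hn _ (c := c) (c' := c') (fun k => ?_) fun k => ?_
  · have := dehornoyFloor_lt hn (hc k)
    push_cast at this
    exact this.le
  · have := (hc' k).inv_of_zpow (by omega)
    rw [inv_pow, inv_inv] at this
    have := le_dehornoyFloor hn (Or.inr this)
    push_cast at this
    exact this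

theorem countP_ofFn {α : Type*} {m : ℕ} (f : Fin m → α) (p : α → Prop) [DecidablePred p] :
    (List.ofFn f).countP (fun a => p a) = (Finset.univ.filter fun j => p (f j)).card := by
  rw [List.ofFn_eq_map, List.countP_map, List.countP_eq_length_filter]
  rfl

end BraidGroup

theorem corollary4p10 (n : ℕ) (hn : 3 ≤ n) (m : ℕ)
    (w : Fin m → BraidGroup n) (i : Fin m → Fin (n - 1)) (ε : Fin m → ℤˣ)
    (β : BraidGroup n)
    (hβ : β = (List.ofFn fun j : Fin m =>
      (w j * BraidGroup.gen (i j) * (w j)⁻¹) ^ ((ε j : ℤˣ) : ℤ)).prod)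
    (pPos pNeg : ℕ)
    (hpPos : pPos = (Finset.univ.filter fun j : Fin m => ε j = 1).card)
    (hpNeg : pNeg = (Finset.univ.filter fun j : Fin m => ε j = -1).card) :
    -- the Dehornoy floors of the powers of `β`, and their limit, are well defined
    (∀ k : ℕ, BraidGroup.IsDehornoyFloor (β ^ k) (BraidGroup.dehornoyFloor (β ^ k))) ∧
    Tendsto (fun k : ℕ => (BraidGroup.dehornoyFloor (β ^ k) : ℝ) / (k : ℝ)) atTop
      (𝓝 (BraidGroup.fdtc β)) ∧
    -- the two bounds
    min (-(pNeg : ℝ) + 1) 0 ≤ BraidGroup.fdtc β ∧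
    BraidGroup.fdtc β ≤ max ((pPos : ℝ) - 1) 0 := by
  refine ⟨fun k => BraidGroup.isDehornoyFloor_dehornoyFloor hn _, ?_⟩
  -- Truncated subtraction in ℕ is the source of the maximum and minimum with 0 in the bounds.
  have hcast : ∀ p : ℕ, ((p - 1 : ℕ) : ℝ) = max ((p : ℝ) - 1) 0 := by
    rintro (- | p)
    · simp
    · rw [Nat.add_sub_cancel, Nat.cast_succ, add_sub_cancel_right, max_eq_left p.cast_nonneg]
  have hmin : min (-(pNeg : ℝ) + 1) 0 = -((pNeg - 1 : ℕ) : ℝ) := by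
    rw [hcast, ← min_neg_neg, neg_zero, neg_sub, neg_add_eq_sub]
  rw [hmin, ← hcast]
  have h := BraidGroup.prod_syllable_fdtc hn (List.ofFn fun j => (w j, i j, ε j))
  rw [BraidGroup.signCount, BraidGroup.signCount,
    BraidGroup.countP_ofFn _ (fun x : BraidGroup n × Fin (n - 1) × ℤˣ => x.2.2 = -1),
    BraidGroup.countP_ofFn _ (fun x : BraidGroup n × Fin (n - 1) × ℤˣ => x.2.2 = 1),
    ← hpPos, ← hpNeg, List.map_ofFn] at h
  rw [hβ]
  exact h
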